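/- There are universal constants $c, C > 0$ such that the following holds. Let $n, d_x, d_y, r$ be integers with $1 \le r \le d_x$, let $A \in \mathbb{R}^{d_y \times d_x}$ with $\operatorname{rank}(A) \le r$, let $\Sigma \in \mathbb{R}^{d_x \times d_x}$ be symmetric positive definite, $\sigma \ge 0$ and $\delta \in (0,1)$. Let $y_i = A x_i + \eta_i$ for $i = 1, \dots, n$, where $x_1, \dots, x_n$ are i.i.d. with distribution $\mathcal{N}(0, \Sigma)$, and $\eta_1, \dots, \eta_n$ are i.i.d. centred sub-Gaussian vectors in $\mathbb{R}^{d_y}$ with variance proxy $\sigma^2$ (that is, $\mathbb{E}\, e^{\langle w, \eta_i\rangle} \le e^{\sigma^2 \|w\|^2/2}$ for all $w \in \mathbb{R}^{d_y}$; for instance $\eta_i \sim \mathcal{N}(0, \sigma^2 I_{d_y})$), independent of $(x_1, \dots, x_n)$. Let $X \in \mathbb{R}^{n \times d_x}$ and $Y \in \mathbb{R}^{n \times d_y}$ be the matrices with rows $x_i^\top$ and $y_i^\top$. Let $\hat A_n$ be the rank-$r$ truncated least-squares estimator (R-LSE), that is, $\hat A_n = \Pi_r(\bar A)$, where $\bar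 A$ is a minimizer of $B \mapsto \|Y - X B^\top\|_{\mathrm F}$ over $\mathbb{R}^{d_y \times d_x}$, and $\Pi_r$ keeps the $r$ leading terms of a singular value decomposition (any choice is allowed where $\bar A$ or the decomposition is not unique). If $$ n \ge c \left( d_x + \log(1/\delta) \right), $$ then, with probability at least $1 - \delta$, $$ \|\hat A_n - A\|_{\mathrm F}^2 \le C \, \frac{r \sigma^2 \left( d_x + d_y + \log(1/\delta) \right)}{n \, \underline{\lambda}^{H}_r(\Sigma)}, \qquad \underline{\lambda}^{H}_r(\Sigma) = \frac{r}{\sum_{i = d_x - r + 1}^{d_x} \frac{1}{\lambda_i(\Sigma)}}, $$ where $\lambda_1(\Sigma) \ge \dots \ge \lambda_{d_x}(\Sigma)$ are the eigenvalues of $\Sigma$. -/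

import Mathlib

open MeasureTheory ProbabilityTheory
open scoped NNReal Matrix Matrix.Norms.Frobenius

/-- `IsSVD M s u v`: the triples `(s i, u i, v i)` form a (compact) singular value decomposition
`M = ∑ i, s i • u i (v i)ᵀ`, with non-negative, non-increasing singular values and orthonormal
families of left and right singular vectors. The number `m` of triples is free, so that singular
values equal to `0` may be listed or omitted. -/
structure IsSVD {p q m : ℕ} (M : Matrix (Fin p) (Fin q) ℝ) (s : Fin m → ℝ)
    (u : Fin m → EuclideanSpace ℝ (Fin p)) (v : Fin m → EuclideanSpace ℝ (Fin q)) : Prop where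
  nonneg : ∀ i, 0 ≤ s i
  antitone : Antitone s
  orthonormal_left : Orthonormal ℝ u
  orthonormal_right : Orthonormal ℝ v
  eq_sum : M = ∑ i, s i • Matrix.vecMulVec (u i) (v i)

/-- `IsRankTruncation k M B`: the matrix `B` is a rank-`k` truncated singular value decomposition
of `M`, that is, `B` keeps the `k` leading terms of some singular value decomposition of `M`
(of all of them if the decomposition has fewer than `k` terms). If the `k`-th and the `(k+1)`-st
singular values of `M` coincide, `B` need not be unique, and every choice is allowed. -/
def IsRankTruncation {p q : ℕ} (k : ℕ) (M B : Matrix (Fin p) (Fin q) ℝ) : Prop :=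
  ∃ (m : ℕ) (s : Fin m → ℝ) (u : Fin m → EuclideanSpace ℝ (Fin p))
    (v : Fin m → EuclideanSpace ℝ (Fin q)), IsSVD M s u v ∧
      B = ∑ i with i.val < k, s i • Matrix.vecMulVec (u i) (v i)

/-- `B` is a least-squares estimator in the model `y = B x + noise`, for the covariates and the
responses in the rows of `X` and `Y`: it minimizes `‖Y - X Bᵀ‖_F`. -/
def IsLSE {n dx dy : ℕ} (X : Matrix (Fin n) (Fin dx) ℝ) (Y : Matrix (Fin n) (Fin dy) ℝ)
    (B : Matrix (Fin dy) (Fin dx) ℝ) : Prop :=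
  ∀ B' : Matrix (Fin dy) (Fin dx) ℝ, ‖Y - X * Bᵀ‖ ≤ ‖Y - X * B'ᵀ‖

/-- `B` is a rank-`r` truncated least-squares estimator: a rank-`r` truncated singular value
decomposition of a least-squares estimator. -/
def IsRLSE {n dx dy : ℕ} (r : ℕ) (X : Matrix (Fin n) (Fin dx) ℝ) (Y : Matrix (Fin n) (Fin dy) ℝ)
    (B : Matrix (Fin dy) (Fin dx) ℝ) : Prop :=
  ∃ Abar : Matrix (Fin dy) (Fin dx) ℝ, IsLSE X Y Abar ∧ IsRankTruncation r Abar B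

/-- The harmonic mean `r / ∑_{i = d - r + 1}^{d} 1 / λ_i(S)` of the `r` smallest eigenvalues
`λ_{d-r+1}(S) ≥ ⋯ ≥ λ_d(S)` of a symmetric `d × d` matrix `S`. The indices of `eigenvalues₀` start
from `0` and the eigenvalues are in non-increasing order. -/
noncomputable def lowerHarmonicMean {d : ℕ} {S : Matrix (Fin d) (Fin d) ℝ} (hS : S.IsHermitian)
    (r : ℕ) : ℝ :=
  (r : ℝ) / ∑ i with d ≤ i.val + r, (hS.eigenvalues₀ i)⁻¹

/-- A random vector is (centred) sub-Gaussian with variance proxy `σ ^ 2` if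
`𝔼 exp(t ⟪w, Z⟫) ≤ exp(σ² ‖w‖² t² / 2)` for every vector `w` and every real `t`. This forces mean
zero, and holds for `Z ∼ 𝒩(0, σ² I)`. -/
def IsSubGaussianVector {Ω : Type*} [MeasurableSpace Ω] {d : ℕ} (Z : Ω → EuclideanSpace ℝ (Fin d))
    (σ : ℝ≥0) (P : Measure Ω) : Prop :=
  ∀ w : EuclideanSpace ℝ (Fin d), HasSubgaussianMGF (fun ω => inner ℝ w (Z ω)) (σ ^ 2 * ‖w‖₊ ^ 2) P

/-! Write `D = Ā - A` and let `B` be the truncation of `Ā`. Eckart-Young gives `‖B - Ā‖ ≤ ‖A - Ā‖`,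
hence `‖B - A‖² ≤ 2⟪B - A, D⟫`. The rows of `B - A` lie in a space `V` of dimension at most `2r`, so
only the restriction of `D` to `V` matters: `‖B - A‖² ≤ 4 ∑ ‖D f_l‖²` for an orthonormal basis `f_l`
of `V` (`IsRankTruncation.exists_norm_sub_sq_le`).

In whitened coordinates the normal equations give `‖D f‖ ≤ (K / κ) ‖Σ^{-1/2} f‖`, where `κ` bounds
the Gram matrix from below and `K` bounds the design-noise cross term (`IsLSE.sum_inner_row_sq_le`).
Summing over `f_l` produces the trace of `Σ⁻¹` on `V`. It is at most the sum of the `2r` largest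
`1/λ_i`, so at most twice the sum of the `r` largest; hence the harmonic mean
(`sum_sum_inner_sq_div_eigenvalues_le`).

Probability enters only through `κ = n/16` and `K²` of order `σ² n (dx + dy + log(1/δ))`, obtained
from sphere nets, chi-square tails and a conditional sub-Gaussian bound (`measure_design_event_le`).
-/

/-! ### Nets of the unit sphere. -/

/-- A finite set of unit vectors with pairwise distances greater than `1 / 10` has at most
`21 ^ dim E` elements. -/
theorem card_le_of_separated_sphere {E : Type*} [NormedAddCommGroup E] [NormedSpace ℝ E]
    [FiniteDimensional ℝ E] (s : Finset E) (hs : ∀ c ∈ s, ‖c‖ = 1)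
    (h : ∀ c ∈ s, ∀ d ∈ s, c ≠ d → 1 / 10 < ‖c - d‖) :
    s.card ≤ 21 ^ Module.finrank ℝ E := by
  borelize E
  let μ : Measure E := Measure.addHaar
  -- Disjoint balls of radius `1/20` inside the ball of radius `21/20`: the volume ratio is `21 ^
  -- dim E`.
  have D : Set.Pairwise (s : Set E)
      (Function.onFun Disjoint fun c => Metric.ball (c : E) (1 / 20)) := by
    rintro c hc d hd hcd
    apply Metric.ball_disjoint_ball
    rw [dist_eq_norm]
    linarith [h c hc d hd hcd]
  have A_subset : (⋃ c ∈ s, Metric.ball (c : E) (1 / 20)) ⊆ Metric.ball (0 : E) (21 / 20) := by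
    refine Set.iUnion₂_subset fun x hx => ?_
    apply Metric.ball_subset_ball'
    rw [dist_zero_right, hs x hx]
    norm_num
  have I : (s.card : ENNReal) * ENNReal.ofReal ((1 / 20) ^ Module.finrank ℝ E)
        * μ (Metric.ball 0 1) ≤
      ENNReal.ofReal ((21 / 20) ^ Module.finrank ℝ E) * μ (Metric.ball 0 1) :=
    calc
      (s.card : ENNReal) * ENNReal.ofReal ((1 / 20) ^ Module.finrank ℝ E) * μ (Metric.ball 0 1)
          = μ (⋃ c ∈ s, Metric.ball (c : E) (1 / 20)) := by
        rw [measure_biUnion_finset D fun c _ => measurableSet_ball]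
        simp only [μ.addHaar_ball_of_pos _ (show (0 : ℝ) < 1 / 20 by norm_num)]
        simp only [Finset.sum_const, nsmul_eq_mul, mul_assoc]
      _ ≤ μ (Metric.ball (0 : E) (21 / 20)) := measure_mono A_subset
      _ = ENNReal.ofReal ((21 / 20) ^ Module.finrank ℝ E) * μ (Metric.ball 0 1) := by
        simp only [μ.addHaar_ball_of_pos _ (show (0 : ℝ) < 21 / 20 by norm_num)]
  have J := (ENNReal.mul_le_mul_iff_left (Metric.measure_ball_pos _ _ zero_lt_one).ne'
    measure_ball_lt_top.ne).1 I
  have K : (s.card : ℝ) ≤ (21 : ℝ) ^ Module.finrank ℝ E := by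
    have h1 := ENNReal.toReal_le_of_le_ofReal (by positivity) J
    rw [ENNReal.toReal_mul, ENNReal.toReal_natCast, ENNReal.toReal_ofReal (by positivity),
      div_pow, div_pow, one_pow, mul_one_div] at h1
    exact (div_le_div_iff_of_pos_right (by positivity)).1 h1
  exact mod_cast K

/-- The unit sphere of a finite-dimensional normed space has a `1 / 10`-net of cardinality at most
`21 ^ dim E`. -/
theorem exists_sphere_net (E : Type*) [NormedAddCommGroup E] [NormedSpace ℝ E]
    [FiniteDimensional ℝ E] :
    ∃ N : Finset E, (∀ v ∈ N, ‖v‖ = 1) ∧ N.card ≤ 21 ^ Module.finrank ℝ E ∧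
      ∀ u : E, ‖u‖ = 1 → ∃ v ∈ N, ‖u - v‖ ≤ 1 / 10 := by
  classical
  -- A separated set of maximal cardinality is a net, since a point far from it could be added.
  let K : Set ℕ := {k | ∃ s : Finset E, (∀ c ∈ s, ‖c‖ = 1) ∧
    (∀ c ∈ s, ∀ d ∈ s, c ≠ d → 1 / 10 < ‖c - d‖) ∧ s.card = k}
  have hbdd : BddAbove K := by
    refine ⟨21 ^ Module.finrank ℝ E, ?_⟩
    rintro k ⟨s, hs, h, rfl⟩
    exact card_le_of_separated_sphere s hs h
  have hne : K.Nonempty := ⟨0, ∅, by simp⟩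
  obtain ⟨s, hs, h, hk⟩ := Nat.sSup_mem hne hbdd
  refine ⟨s, hs, card_le_of_separated_sphere s hs h, fun u hu => ?_⟩
  by_contra! hfar
  have hus : u ∉ s := fun hmem => by
    have := hfar u hmem
    norm_num at this
  have hmem : s.card + 1 ∈ K := by
    refine ⟨insert u s, ?_, ?_, Finset.card_insert_of_notMem hus⟩
    · simpa [hu] using hs
    · intro c hc d hd hcd
      rcases Finset.mem_insert.1 hc with rfl | hc' <;> rcases Finset.mem_insert.1 hd with rfl | hd'
      · exact absurd rfl hcd
      · exact hfar d hd'
      · rw [norm_sub_rev]; exact hfar c hc'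
      · exact h c hc' d hd' hcd
  have := le_csSup hbdd hmem
  omega

/-- The operator norm is controlled by the values on a `1 / 10`-net of the unit sphere. -/
theorem opNorm_le_of_sphere_net {E F : Type*} [NormedAddCommGroup E] [NormedSpace ℝ E]
    [NormedAddCommGroup F] [NormedSpace ℝ F] (L : E →L[ℝ] F) (N : Finset E)
    (hN : ∀ u : E, ‖u‖ = 1 → ∃ v ∈ N, ‖u - v‖ ≤ 1 / 10) {t : ℝ} (ht : 0 ≤ t)
    (hL : ∀ v ∈ N, ‖L v‖ ≤ t) : ‖L‖ ≤ t / (9 / 10) := by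
  -- `‖L‖` occurs on both sides and is absorbed into the left one.
  have h : ‖L‖ ≤ t + ‖L‖ * (1 / 10) := by
    refine L.opNorm_le_of_unit_norm (by positivity) fun u hu => ?_
    obtain ⟨v, hv, huv⟩ := hN u hu
    calc ‖L u‖ = ‖L v + L (u - v)‖ := by rw [map_sub]; congr 1; abel
      _ ≤ ‖L v‖ + ‖L (u - v)‖ := norm_add_le _ _
      _ ≤ t + ‖L‖ * ‖u - v‖ := add_le_add (hL v hv) (L.le_opNorm _)
      _ ≤ t + ‖L‖ * (1 / 10) := by gcongr
  rw [le_div_iff₀ (by norm_num)]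
  linarith

/-- If `a ≤ ‖L v‖ ≤ b` on a `1 / 10`-net of the unit sphere, then `L` is bounded below. -/
theorem norm_ge_of_sphere_net {E F : Type*} [NormedAddCommGroup E] [NormedSpace ℝ E]
    [NormedAddCommGroup F] [NormedSpace ℝ F] (L : E →L[ℝ] F) (N : Finset E)
    (hN : ∀ u : E, ‖u‖ = 1 → ∃ v ∈ N, ‖u - v‖ ≤ 1 / 10) {a b : ℝ} (hb : 0 ≤ b)
    (hLa : ∀ v ∈ N, a ≤ ‖L v‖) (hLb : ∀ v ∈ N, ‖L v‖ ≤ b) (u : E) :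
    (a - b / 9) * ‖u‖ ≤ ‖L u‖ := by
  have hL := opNorm_le_of_sphere_net L N hN hb hLb
  rcases eq_or_ne u 0 with rfl | hu
  · simp
  have hu' : 0 < ‖u‖ := norm_pos_iff.2 hu
  obtain ⟨v, hv, huv⟩ := hN (‖u‖⁻¹ • u) (norm_smul_inv_norm hu)
  have h1 : ‖L v‖ ≤ ‖L (‖u‖⁻¹ • u)‖ + b / 9 := by
    calc ‖L v‖ = ‖L (‖u‖⁻¹ • u) - L (‖u‖⁻¹ • u - v)‖ := by rw [map_sub L _ v]; congr 1; abel
      _ ≤ ‖L (‖u‖⁻¹ • u)‖ + ‖L (‖u‖⁻¹ • u - v)‖ := norm_sub_le _ _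
      _ ≤ ‖L (‖u‖⁻¹ • u)‖ + ‖L‖ * ‖‖u‖⁻¹ • u - v‖ := by gcongr; exact L.le_opNorm _
      _ ≤ ‖L (‖u‖⁻¹ • u)‖ + b / (9 / 10) * (1 / 10) := by gcongr
      _ = ‖L (‖u‖⁻¹ • u)‖ + b / 9 := by ring
  have h2 : ‖L (‖u‖⁻¹ • u)‖ = ‖L u‖ / ‖u‖ := by
    rw [map_smul, norm_smul, norm_inv, norm_norm]; ring
  rw [h2] at h1
  rw [← le_div_iff₀ hu']
  linarith [hLa v hv]

/-! ### Chi-square tails. -/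

theorem integral_exp_mul_sq_gaussianReal {t : ℝ} (ht : t < 1 / 2) :
    Integrable (fun x => Real.exp (t * x ^ 2)) (gaussianReal 0 1) ∧
      ∫ x, Real.exp (t * x ^ 2) ∂(gaussianReal 0 1) = (√(1 - 2 * t))⁻¹ := by
  have hpdf : ∀ x : ℝ, gaussianPDFReal 0 1 x * Real.exp (t * x ^ 2) =
      (√(2 * Real.pi))⁻¹ * Real.exp (-(1 / 2 - t) * x ^ 2) := fun x => by
    rw [gaussianPDFReal, mul_assoc, ← Real.exp_add]
    simp only [NNReal.coe_one, mul_one, sub_zero]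
    congr 2
    ring
  constructor
  · rw [gaussianReal_of_var_ne_zero _ one_ne_zero]
    rw [integrable_withDensity_iff_integrable_smul' (measurable_gaussianPDF _ _)
      (ae_of_all _ fun _ => gaussianPDF_lt_top)]
    simp only [toReal_gaussianPDF, smul_eq_mul, hpdf]
    exact (integrable_exp_neg_mul_sq (by linarith)).const_mul _
  · rw [integral_gaussianReal_eq_integral_smul one_ne_zero]
    simp only [smul_eq_mul, hpdf]
    rw [integral_const_mul, integral_gaussian, ← Real.sqrt_inv, ← Real.sqrt_mul (by positivity),
      ← Real.sqrt_inv]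
    congr 1
    have : 1 / 2 - t ≠ 0 := by linarith
    have : 1 - 2 * t ≠ 0 := by linarith
    field_simp

section ChiSquare

variable {Ω : Type*} [MeasurableSpace Ω] {P : Measure Ω} {n : ℕ} {g : Fin n → Ω → ℝ}

theorem mgf_sum_sq_of_gaussian (hg : ∀ i, HasLaw (g i) (gaussianReal 0 1) P)
    (hind : iIndepFun g P) {t : ℝ} (ht : t < 1 / 2) :
    Integrable (fun ω => Real.exp (t * ∑ i, g i ω ^ 2)) P ∧
      mgf (fun ω => ∑ i, g i ω ^ 2) P t = (√(1 - 2 * t))⁻¹ ^ n := by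
  have : IsProbabilityMeasure P := hind.isProbabilityMeasure
  have hmeas : ∀ i, AEMeasurable (fun ω => g i ω ^ 2) P := fun i => (hg i).aemeasurable.pow_const 2
  have hind2 : iIndepFun (fun i ω => g i ω ^ 2) P :=
    hind.comp (fun _ x => x ^ 2) fun _ => by fun_prop
  obtain ⟨hint, hval⟩ := integral_exp_mul_sq_gaussianReal ht
  have hmgf : mgf (fun ω => ∑ i, g i ω ^ 2) P t = (√(1 - 2 * t))⁻¹ ^ n := by
    have h1 := hind2.mgf_sum₀ (t := t) hmeas Finset.univ
    have h2 : (∑ i, fun ω => g i ω ^ 2) = fun ω => ∑ i, g i ω ^ 2 := by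
      ext ω; simp
    rw [h2] at h1
    rw [h1, Finset.prod_eq_pow_card (b := (√(1 - 2 * t))⁻¹), Finset.card_univ, Fintype.card_fin]
    intro i _
    rw [mgf, ← hval]
    exact (hg i).integral_comp (f := fun x => Real.exp (t * x ^ 2)) (by fun_prop)
  refine ⟨?_, hmgf⟩
  -- The integral of a non-integrable function is `0` by convention, but the value found is
  -- positive.
  by_contra hnot
  have h0 : mgf (fun ω => ∑ i, g i ω ^ 2) P t = 0 := integral_undef hnot
  have : 0 < (√(1 - 2 * t))⁻¹ ^ n := by
    have : 0 < 1 - 2 * t := by linarith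
    positivity
  rw [← hmgf, h0] at this
  exact lt_irrefl _ this

/-- Chernoff bound at `t = 1/4`: `e^{-n} 2^{n/2} ≤ e^{-n/4}`, because `√2 ≤ e^{3/4}`. -/
theorem measure_sum_sq_ge_le (hg : ∀ i, HasLaw (g i) (gaussianReal 0 1) P)
    (hind : iIndepFun g P) :
    P {ω | 4 * (n : ℝ) ≤ ∑ i, g i ω ^ 2} ≤ ENNReal.ofReal (Real.exp (-(n / 4 : ℝ))) := by
  have : IsProbabilityMeasure P := hind.isProbabilityMeasure
  obtain ⟨hint, hval⟩ := mgf_sum_sq_of_gaussian hg hind (t := 1 / 4) (by norm_num)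
  have h := measure_ge_le_exp_mul_mgf (4 * (n : ℝ)) (by norm_num) hint
  rw [← ofReal_measureReal]
  refine ENNReal.ofReal_le_ofReal (h.trans ?_)
  rw [hval]
  have h1 : (√(1 - 2 * (1 / 4 : ℝ)))⁻¹ ≤ Real.exp (3 / 4) := by
    rw [← Real.sqrt_inv, Real.sqrt_le_left (by positivity), ← Real.exp_nat_mul]
    have := Real.add_one_le_exp (2 * (3 / 4) : ℝ)
    norm_num at this ⊢
    linarith
  calc Real.exp (-(1 / 4) * (4 * n)) * (√(1 - 2 * (1 / 4 : ℝ)))⁻¹ ^ n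
      ≤ Real.exp (-(1 / 4) * (4 * n)) * Real.exp (3 / 4) ^ n := by gcongr
    _ = Real.exp (-(n / 4)) := by
        rw [← Real.exp_nat_mul, ← Real.exp_add]; congr 1; ring

/-- Chernoff bound at `t = -3/2`: `e^{3n/8} 2^{-n} ≤ e^{-n/4}`, because `e^{5/8} ≤ 2`. -/
theorem measure_sum_sq_le_le (hg : ∀ i, HasLaw (g i) (gaussianReal 0 1) P)
    (hind : iIndepFun g P) :
    P {ω | ∑ i, g i ω ^ 2 ≤ (n : ℝ) / 4} ≤ ENNReal.ofReal (Real.exp (-(n / 4 : ℝ))) := by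
  have : IsProbabilityMeasure P := hind.isProbabilityMeasure
  obtain ⟨hint, hval⟩ := mgf_sum_sq_of_gaussian hg hind (t := -(3 / 2)) (by norm_num)
  have h := measure_le_le_exp_mul_mgf ((n : ℝ) / 4) (by norm_num) hint
  rw [← ofReal_measureReal]
  refine ENNReal.ofReal_le_ofReal (h.trans ?_)
  rw [hval]
  have h1 : (√(1 - 2 * (-(3 / 2) : ℝ)))⁻¹ ≤ Real.exp (-(5 / 8)) := by
    rw [Real.exp_neg]
    gcongr
    have h4 : √(1 - 2 * (-(3 / 2) : ℝ)) = 2 := by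
      rw [show (1 - 2 * (-(3 / 2) : ℝ)) = 2 ^ 2 by norm_num]
      exact Real.sqrt_sq (by norm_num)
    rw [h4, ← Real.le_log_iff_exp_le (by norm_num)]
    linarith [Real.log_two_gt_d9]
  calc Real.exp (-(-(3 / 2)) * (n / 4)) * (√(1 - 2 * (-(3 / 2) : ℝ)))⁻¹ ^ n
      ≤ Real.exp (-(-(3 / 2)) * (n / 4)) * Real.exp (-(5 / 8)) ^ n := by gcongr
    _ = Real.exp (-(n / 4)) := by
        rw [← Real.exp_nat_mul, ← Real.exp_add]; congr 1; ring

end ChiSquare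

/-! ### Sub-Gaussian noise with random weights. -/

section Noise

variable {Ω : Type*} [MeasurableSpace Ω] {P : Measure Ω} {n : ℕ}

theorem ProbabilityTheory.HasSubgaussianMGF.mono {X : Ω → ℝ} {c c' : ℝ≥0}
    (h : HasSubgaussianMGF X c P) (hc : c ≤ c') : HasSubgaussianMGF X c' P :=
  ⟨h.integrable_exp_mul, fun t => (h.mgf_le t).trans <| by gcongr⟩

theorem hasSubgaussianMGF_weighted_sum {b : Fin n → Ω → ℝ} {σ : ℝ≥0}
    (hb : ∀ i, HasSubgaussianMGF (b i) (σ ^ 2) P) (hind : iIndepFun b P)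
    (v : Fin n → ℝ) {M : ℝ≥0} (hv : ∑ i, v i ^ 2 ≤ M) :
    HasSubgaussianMGF (fun ω => ∑ i, v i * b i ω) (M * σ ^ 2) P := by
  have hind' : iIndepFun (fun i ω => v i * b i ω) P :=
    hind.comp (fun i x => v i * x) fun _ => by fun_prop
  refine (HasSubgaussianMGF.sum_of_iIndepFun hind' (s := Finset.univ)
    fun i _ => (hb i).const_mul (v i)).mono ?_
  rw [← NNReal.coe_le_coe, NNReal.coe_sum]
  calc ∑ i, v i ^ 2 * (σ : ℝ) ^ 2 = (∑ i, v i ^ 2) * (σ : ℝ) ^ 2 := by rw [Finset.sum_mul]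
    _ ≤ M * (σ : ℝ) ^ 2 := by gcongr
    _ = ((M * σ ^ 2 : ℝ≥0) : ℝ) := by push_cast; rfl

theorem measure_lt_abs_le {X : Ω → ℝ} [IsProbabilityMeasure P] {M σ : ℝ≥0} (hM : M ≠ 0) {s : ℝ}
    (hs : 0 ≤ s) (hX : HasSubgaussianMGF X (M * σ ^ 2) P) :
    P {ω | σ * √(2 * M * s) < |X ω|} ≤ ENNReal.ofReal (2 * Real.exp (-s)) := by
  -- For `σ = 0` the threshold is `0` and `X = 0` almost surely; the strict inequality makes the
  -- event null.
  rcases eq_or_ne σ 0 with rfl | hσ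
  · have h0 : X =ᵐ[P] 0 := by
      apply HasSubgaussianMGF.ae_eq_zero_of_hasSubgaussianMGF_zero
      simpa using hX
    have : P {ω | ((0 : ℝ≥0) : ℝ) * √(2 * M * s) < |X ω|} = 0 := by
      rw [measure_eq_zero_iff_ae_notMem]
      filter_upwards [h0] with ω hω
      simp [hω]
    rw [this]
    exact zero_le
  have hσ' : 0 < (σ : ℝ) := by exact_mod_cast pos_iff_ne_zero.2 hσ
  have hM' : 0 < (M : ℝ) := by exact_mod_cast pos_iff_ne_zero.2 hM
  have key : ∀ Y : Ω → ℝ, HasSubgaussianMGF Y (M * σ ^ 2) P →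
      P.real {ω | σ * √(2 * M * s) ≤ Y ω} ≤ Real.exp (-s) := fun Y hY => by
    refine (hY.measure_ge_le (by positivity)).trans (le_of_eq ?_)
    congr 1
    rw [mul_pow, Real.sq_sqrt (by positivity)]
    push_cast
    field_simp
  have hsub : {ω | σ * √(2 * M * s) < |X ω|} ⊆
      {ω | σ * √(2 * M * s) ≤ X ω} ∪ {ω | σ * √(2 * M * s) ≤ (-X) ω} := fun ω hω => by
    rw [Set.mem_ofPred_eq] at hω
    rcases lt_abs.1 hω with h | h
    · exact Or.inl h.le
    · exact Or.inr h.le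
  rw [← ofReal_measureReal]
  refine ENNReal.ofReal_le_ofReal ?_
  refine (measureReal_mono hsub).trans ((measureReal_union_le _ _).trans ?_)
  linarith [key X hX, key (-X) hX.neg]

/-- By independence the weights `a` can be frozen (Fubini). The clause `∑ a² ≤ M` in the event then
gives a deterministic variance proxy `M σ²`. -/
theorem measure_noise_le [IsProbabilityMeasure P] {a b : Fin n → Ω → ℝ} {M σ : ℝ≥0} (hM : M ≠ 0)
    {s : ℝ} (hs : 0 ≤ s) (ha : ∀ i, AEMeasurable (a i) P)
    (hb : ∀ i, HasSubgaussianMGF (b i) (σ ^ 2) P) (hind : iIndepFun b P)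
    (hab : IndepFun (fun ω i => a i ω) (fun ω i => b i ω) P) :
    P {ω | σ * √(2 * M * s) < |∑ i, a i ω * b i ω| ∧ ∑ i, a i ω ^ 2 ≤ M} ≤
      ENNReal.ofReal (2 * Real.exp (-s)) := by
  have ha' : AEMeasurable (fun ω i => a i ω) P := aemeasurable_pi_lambda _ ha
  have hb' : AEMeasurable (fun ω i => b i ω) P := aemeasurable_pi_lambda _ fun i => (hb i).aemeasurable
  let T : Set ((Fin n → ℝ) × (Fin n → ℝ)) :=
    {p | σ * √(2 * M * s) < |∑ i, p.1 i * p.2 i| ∧ ∑ i, p.1 i ^ 2 ≤ M}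
  have hT : MeasurableSet T :=
    MeasurableSet.inter
      (s₁ := {p : (Fin n → ℝ) × (Fin n → ℝ) | σ * √(2 * M * s) < |∑ i, p.1 i * p.2 i|})
      (s₂ := {p : (Fin n → ℝ) × (Fin n → ℝ) | ∑ i, p.1 i ^ 2 ≤ M})
      (measurableSet_lt (by fun_prop) (by fun_prop))
      (measurableSet_le (by fun_prop) (by fun_prop))
  have hmap := (indepFun_iff_map_prod_eq_prod_map_map ha' hb').1 hab
  have : IsProbabilityMeasure (P.map fun ω i => a i ω) := Measure.isProbabilityMeasure_map ha'
  calc P {ω | σ * √(2 * M * s) < |∑ i, a i ω * b i ω| ∧ ∑ i, a i ω ^ 2 ≤ M}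
      = (P.map fun ω => ((fun i => a i ω), fun i => b i ω)) T := by
        rw [Measure.map_apply_of_aemeasurable (ha'.prodMk hb') hT]; rfl
    _ = ∫⁻ v, (P.map fun ω i => b i ω) (Prod.mk v ⁻¹' T) ∂(P.map fun ω i => a i ω) := by
        rw [hmap, Measure.prod_apply hT]
    _ ≤ ∫⁻ _, ENNReal.ofReal (2 * Real.exp (-s)) ∂(P.map fun ω i => a i ω) := by
        refine lintegral_mono fun v => ?_
        rw [Measure.map_apply_of_aemeasurable hb' (measurable_prodMk_left hT)]
        by_cases hv : ∑ i, v i ^ 2 ≤ M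
        · refine (measure_mono fun ω hω => ?_).trans
            (measure_lt_abs_le hM hs (hasSubgaussianMGF_weighted_sum hb hind v hv))
          exact hω.1
        · have : (fun ω i => b i ω) ⁻¹' (Prod.mk v ⁻¹' T) = ∅ := by
            ext ω
            simp only [Set.mem_preimage, Set.mem_empty_iff_false, iff_false]
            exact fun h => hv h.2
          rw [this, measure_empty]
          exact zero_le
    _ = ENNReal.ofReal (2 * Real.exp (-s)) := by simp

end Noise

/-! ### The good event for the whitened design and the noise. -/

section Design

variable {n dx dy : ℕ}

/-- The linear map `u ↦ (⟪u, z i⟫)ᵢ`. -/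
noncomputable def designMap (z : Fin n → EuclideanSpace ℝ (Fin dx)) :
    EuclideanSpace ℝ (Fin dx) →L[ℝ] EuclideanSpace ℝ (Fin n) :=
  LinearMap.toContinuousLinearMap
    { toFun := fun u => WithLp.toLp 2 fun i => inner ℝ u (z i)
      map_add' := fun u v => by ext i; simp [inner_add_left]
      map_smul' := fun c u => by ext i; simp [real_inner_smul_left] }

theorem norm_sq_designMap (z : Fin n → EuclideanSpace ℝ (Fin dx)) (u : EuclideanSpace ℝ (Fin dx)) :
    ‖designMap z u‖ ^ 2 = ∑ i, inner ℝ u (z i) ^ 2 := by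
  simp [designMap, EuclideanSpace.real_norm_sq_eq]

/-- The linear map `u ↦ ∑ i, ⟪u, z i⟫ • η i`. -/
noncomputable def crossMap (z : Fin n → EuclideanSpace ℝ (Fin dx))
    (η : Fin n → EuclideanSpace ℝ (Fin dy)) :
    EuclideanSpace ℝ (Fin dx) →L[ℝ] EuclideanSpace ℝ (Fin dy) :=
  LinearMap.toContinuousLinearMap
    { toFun := fun u => ∑ i, (inner ℝ u (z i) : ℝ) • η i
      map_add' := fun u v => by simp [inner_add_left, add_smul, Finset.sum_add_distrib]
      map_smul' := fun c u => by simp [real_inner_smul_left, mul_smul, Finset.smul_sum] }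

theorem inner_crossMap (z : Fin n → EuclideanSpace ℝ (Fin dx))
    (η : Fin n → EuclideanSpace ℝ (Fin dy)) (u : EuclideanSpace ℝ (Fin dx))
    (w : EuclideanSpace ℝ (Fin dy)) :
    inner ℝ w (crossMap z η u) = ∑ i, inner ℝ u (z i) * inner ℝ w (η i) := by
  simp [crossMap, inner_sum, real_inner_smul_right]

theorem designMap_lower_bound (z : Fin n → EuclideanSpace ℝ (Fin dx))
    (N : Finset (EuclideanSpace ℝ (Fin dx)))
    (hN : ∀ u : EuclideanSpace ℝ (Fin dx), ‖u‖ = 1 → ∃ v ∈ N, ‖u - v‖ ≤ 1 / 10)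
    (hlow : ∀ v ∈ N, (n : ℝ) / 4 ≤ ∑ i, inner ℝ v (z i) ^ 2)
    (hup : ∀ v ∈ N, ∑ i, inner ℝ v (z i) ^ 2 ≤ 4 * (n : ℝ)) (u : EuclideanSpace ℝ (Fin dx)) :
    (n : ℝ) / 16 * ‖u‖ ^ 2 ≤ ∑ i, inner ℝ u (z i) ^ 2 := by
  have hsq : √(n : ℝ) ^ 2 = n := Real.sq_sqrt (by positivity)
  -- `1/2 - 2/9 = 5/18 ≥ 1/4`, whose square is the `1/16` of the conclusion.
  have h := norm_ge_of_sphere_net (designMap z) N hN (a := √n / 2) (b := 2 * √n) (by positivity)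
    (fun v hv => ?_) (fun v hv => ?_) u
  · rw [← norm_sq_designMap, ← hsq]
    calc √(n : ℝ) ^ 2 / 16 * ‖u‖ ^ 2 = (√(n : ℝ) / 4 * ‖u‖) ^ 2 := by ring
      _ ≤ ((√n / 2 - 2 * √n / 9) * ‖u‖) ^ 2 := by
        gcongr
        linarith [Real.sqrt_nonneg (n : ℝ)]
      _ ≤ ‖designMap z u‖ ^ 2 := by
        refine pow_le_pow_left₀ (mul_nonneg ?_ (norm_nonneg _)) h 2
        linarith [Real.sqrt_nonneg (n : ℝ)]
  · refine (pow_le_pow_iff_left₀ (by positivity) (by positivity) two_ne_zero).1 ?_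
    rw [norm_sq_designMap, div_pow, hsq]
    linarith [hlow v hv]
  · refine (pow_le_pow_iff_left₀ (by positivity) (by positivity) two_ne_zero).1 ?_
    rw [norm_sq_designMap, mul_pow, hsq]
    linarith [hup v hv]

/-- Two nested net arguments: `Ny` for the norm of each image vector, seen as a functional, then
`Nx` for the operator norm. Each costs a factor `10/9`, and `(10/9)² ≤ 2`. -/
theorem crossMap_upper_bound (z : Fin n → EuclideanSpace ℝ (Fin dx))
    (η : Fin n → EuclideanSpace ℝ (Fin dy))
    (Nx : Finset (EuclideanSpace ℝ (Fin dx))) (Ny : Finset (EuclideanSpace ℝ (Fin dy)))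
    (hNx : ∀ u : EuclideanSpace ℝ (Fin dx), ‖u‖ = 1 → ∃ v ∈ Nx, ‖u - v‖ ≤ 1 / 10)
    (hNy : ∀ u : EuclideanSpace ℝ (Fin dy), ‖u‖ = 1 → ∃ v ∈ Ny, ‖u - v‖ ≤ 1 / 10)
    {t : ℝ} (ht : 0 ≤ t)
    (h : ∀ v ∈ Nx, ∀ w ∈ Ny, |∑ i, inner ℝ v (z i) * inner ℝ w (η i)| ≤ t)
    (u : EuclideanSpace ℝ (Fin dx)) (w : EuclideanSpace ℝ (Fin dy)) :
    ∑ i, inner ℝ u (z i) * inner ℝ w (η i) ≤ 2 * t * ‖u‖ * ‖w‖ := by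
  have h1 : ∀ v ∈ Nx, ‖crossMap z η v‖ ≤ t / (9 / 10) := fun v hv => by
    rw [← innerSL_apply_norm (𝕜 := ℝ)]
    refine opNorm_le_of_sphere_net _ Ny hNy ht fun w hw => ?_
    rw [innerSL_apply_apply, real_inner_comm, inner_crossMap, Real.norm_eq_abs]
    exact h v hv w hw
  have h2 := opNorm_le_of_sphere_net _ Nx hNx (by positivity) h1
  rw [← inner_crossMap]
  calc inner ℝ w (crossMap z η u) ≤ ‖w‖ * ‖crossMap z η u‖ := real_inner_le_norm _ _
    _ ≤ ‖w‖ * (‖crossMap z η‖ * ‖u‖) := by gcongr; exact ContinuousLinearMap.le_opNorm _ _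
    _ ≤ ‖w‖ * (t / (9 / 10) / (9 / 10) * ‖u‖) := by gcongr
    _ = (t / (9 / 10) / (9 / 10)) * (‖u‖ * ‖w‖) := by ring
    _ ≤ (2 * t) * (‖u‖ * ‖w‖) := by
        gcongr
        rw [div_div, div_le_iff₀ (by norm_num)]
        linarith
    _ = 2 * t * ‖u‖ * ‖w‖ := by ring

theorem twenty_one_le_exp : (21 : ℝ) ≤ Real.exp 4 := by
  have h : Real.exp 4 = Real.exp 1 ^ 4 := by rw [← Real.exp_nat_mul]; norm_num
  rw [h]
  have h1 : (2.7 : ℝ) ≤ Real.exp 1 := by linarith [Real.exp_one_gt_d9]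
  calc (21 : ℝ) ≤ 2.7 ^ 4 := by norm_num
    _ ≤ _ := by gcongr

/-- The `6` splits as `4 + 2`: `21 ≤ e⁴` pays for the net and the remaining `e^{-2} ≤ 1/4` pays for
the factor `2` and the halving of `δ`. -/
theorem net_union_bound {d e : ℕ} (hd : 1 ≤ d) (hde : d ≤ e) {δ s : ℝ} (hδ : 0 < δ)
    (hs : 6 * e + Real.log (1 / δ) ≤ s) :
    (21 : ℝ) ^ e * (2 * Real.exp (-s)) ≤ δ / 2 := by
  have he : (1 : ℝ) ≤ e := by exact_mod_cast hd.trans hde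
  have h4 : (4 : ℝ) ≤ Real.exp 2 := by
    have h : Real.exp 2 = Real.exp 1 ^ 2 := by rw [← Real.exp_nat_mul]; norm_num
    rw [h]
    nlinarith [Real.exp_one_gt_d9]
  have h2 : Real.exp (-2 : ℝ) ≤ 1 / 4 := by
    rw [Real.exp_neg, ← one_div]
    gcongr
  calc (21 : ℝ) ^ e * (2 * Real.exp (-s))
      ≤ Real.exp 4 ^ e * (2 * Real.exp (-(6 * e + Real.log (1 / δ)))) := by
        gcongr
        exact twenty_one_le_exp
    _ = 2 * Real.exp (-2 * e) * δ := by
        have h : (-2 : ℝ) * e = e * 4 + -(6 * e) := by ring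
        rw [← Real.exp_nat_mul, one_div, Real.log_inv, neg_add, neg_neg, Real.exp_add,
          Real.exp_log hδ, h, Real.exp_add]
        ring
    _ ≤ 2 * Real.exp (-2) * δ := by gcongr; linarith
    _ ≤ 2 * (1 / 4) * δ := by gcongr
    _ = δ / 2 := by ring

variable {Ω : Type*} [MeasurableSpace Ω] {P : Measure Ω}

/-- With high probability, a whitened Gaussian design is well conditioned and almost orthogonal
to the sub-Gaussian noise. -/
theorem measure_design_event_le [IsProbabilityMeasure P] (hdx : 1 ≤ dx) {δ : ℝ} (hδ : 0 < δ)
    (hδ1 : δ < 1) (hn : 24 * (dx + Real.log (1 / δ)) ≤ n) {σ : ℝ≥0}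
    (z : Fin n → Ω → EuclideanSpace ℝ (Fin dx)) (η : Fin n → Ω → EuclideanSpace ℝ (Fin dy))
    (hz : ∀ u : EuclideanSpace ℝ (Fin dx), ‖u‖ = 1 →
      ∀ i, HasLaw (fun ω => inner ℝ u (z i ω)) (gaussianReal 0 1) P)
    (hzi : iIndepFun z P) (hη : ∀ i, IsSubGaussianVector (η i) σ P) (hηi : iIndepFun η P)
    (hzη : IndepFun (fun ω i => z i ω) (fun ω i => η i ω) P) :
    P {ω | ¬ ((∀ u, (n : ℝ) / 16 * ‖u‖ ^ 2 ≤ ∑ i, inner ℝ u (z i ω) ^ 2) ∧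
      ∀ u w, ∑ i, inner ℝ u (z i ω) * inner ℝ w (η i ω) ≤
        2 * (σ * √(8 * n * (6 * (dx + dy) + Real.log (1 / δ)))) * ‖u‖ * ‖w‖)}
      ≤ ENNReal.ofReal δ := by
  obtain ⟨Nx, hNx1, hNxc, hNx⟩ := exists_sphere_net (EuclideanSpace ℝ (Fin dx))
  obtain ⟨Ny, hNy1, hNyc, hNy⟩ := exists_sphere_net (EuclideanSpace ℝ (Fin dy))
  rw [finrank_euclideanSpace_fin] at hNxc hNyc
  have hlog : 0 ≤ Real.log (1 / δ) := Real.log_nonneg (by rw [le_div_iff₀ hδ]; linarith)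
  have hdx' : (1 : ℝ) ≤ dx := by exact_mod_cast hdx
  have hn0 : (0 : ℝ) < n := by nlinarith
  set s : ℝ := 6 * (dx + dy) + Real.log (1 / δ) with hs
  have hs0 : 0 ≤ s := by positivity
  -- Outside the chi-square events the weights have square sum at most `4n`, so the noise bound
  -- applies with this `M`.
  let M : ℝ≥0 := 4 * n
  have hM : M ≠ 0 := by
    have : (n : ℝ≥0) ≠ 0 := by exact_mod_cast hn0.ne'
    simp only [M]
    positivity
  have hMr : (M : ℝ) = 4 * n := by simp [M]
  let G : EuclideanSpace ℝ (Fin dx) → Set Ω := fun v =>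
    {ω | 4 * (n : ℝ) ≤ ∑ i, inner ℝ v (z i ω) ^ 2} ∪
      {ω | ∑ i, inner ℝ v (z i ω) ^ 2 ≤ (n : ℝ) / 4}
  let B : EuclideanSpace ℝ (Fin dx) → EuclideanSpace ℝ (Fin dy) → Set Ω := fun v w =>
    {ω | σ * √(2 * M * s) < |∑ i, inner ℝ v (z i ω) * inner ℝ w (η i ω)| ∧
      ∑ i, inner ℝ v (z i ω) ^ 2 ≤ M}
  have hG : ∀ v ∈ Nx, P (G v) ≤ ENNReal.ofReal (2 * Real.exp (-(n / 4 : ℝ))) := fun v hv => by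
    have hi : iIndepFun (fun i ω => inner ℝ v (z i ω) : Fin n → Ω → ℝ) P :=
      hzi.comp (fun _ x => inner ℝ v x) fun _ => by fun_prop
    refine (measure_union_le _ _).trans ?_
    rw [two_mul, ENNReal.ofReal_add (by positivity) (by positivity)]
    exact add_le_add (measure_sum_sq_ge_le (hz v (hNx1 v hv)) hi)
      (measure_sum_sq_le_le (hz v (hNx1 v hv)) hi)
  have hB : ∀ v ∈ Nx, ∀ w ∈ Ny, P (B v w) ≤ ENNReal.ofReal (2 * Real.exp (-s)) :=
      fun v hv w hw => by
    have hsub : ∀ i, HasSubgaussianMGF (fun ω => inner ℝ w (η i ω)) (σ ^ 2) P := fun i => by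
      have hw1 : ‖w‖₊ = 1 := NNReal.eq (hNy1 w hw)
      have := hη i w
      rwa [hw1, one_pow, mul_one] at this
    have hi : iIndepFun (fun i ω => inner ℝ w (η i ω) : Fin n → Ω → ℝ) P :=
      hηi.comp (fun _ x => inner ℝ w x) fun _ => by fun_prop
    have hφ : Measurable fun (x : Fin n → EuclideanSpace ℝ (Fin dx)) (i : Fin n) =>
      (inner ℝ v (x i) : ℝ) := by fun_prop
    have hψ : Measurable fun (y : Fin n → EuclideanSpace ℝ (Fin dy)) (i : Fin n) =>
      (inner ℝ w (y i) : ℝ) := by fun_prop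
    have hab : IndepFun (fun ω i => inner ℝ v (z i ω) : Ω → Fin n → ℝ)
      (fun ω i => inner ℝ w (η i ω) : Ω → Fin n → ℝ) P := hzη.comp hφ hψ
    exact measure_noise_le hM hs0 (fun i => (hz v (hNx1 v hv) i).aemeasurable) hsub hi hab
  have hsub : {ω | ¬ ((∀ u, (n : ℝ) / 16 * ‖u‖ ^ 2 ≤ ∑ i, inner ℝ u (z i ω) ^ 2) ∧
      ∀ u w, ∑ i, inner ℝ u (z i ω) * inner ℝ w (η i ω) ≤
        2 * (σ * √(8 * n * s)) * ‖u‖ * ‖w‖)} ⊆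
      (⋃ v ∈ Nx, G v) ∪ ⋃ v ∈ Nx, ⋃ w ∈ Ny, B v w := by
    intro ω hω
    by_contra hnot
    simp only [Set.mem_union, Set.mem_iUnion, not_or, not_exists] at hnot
    obtain ⟨hnG, hnB⟩ := hnot
    refine hω ?_
    have hup : ∀ v ∈ Nx, ∑ i, inner ℝ v (z i ω) ^ 2 ≤ 4 * (n : ℝ) := fun v hv => by
      by_contra! h
      exact hnG v hv (Or.inl h.le)
    have hlow : ∀ v ∈ Nx, (n : ℝ) / 4 ≤ ∑ i, inner ℝ v (z i ω) ^ 2 := fun v hv => by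
      by_contra! h
      exact hnG v hv (Or.inr h.le)
    refine ⟨designMap_lower_bound (fun i => z i ω) Nx hNx hlow hup, ?_⟩
    refine crossMap_upper_bound (fun i => z i ω) (fun i => η i ω) Nx Ny hNx hNy (by positivity)
      fun v hv w hw => ?_
    by_contra! h
    refine hnB v hv w hw ⟨?_, (hup v hv).trans hMr.ge⟩
    rwa [hMr, show 2 * (4 * (n : ℝ)) * s = 8 * n * s by ring]
  refine (measure_mono hsub).trans ((measure_union_le _ _).trans ?_)
  rw [← add_halves δ, ENNReal.ofReal_add (by positivity) (by positivity)]
  refine add_le_add ?_ ?_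
  · calc P (⋃ v ∈ Nx, G v) ≤ ∑ v ∈ Nx, P (G v) := measure_biUnion_finset_le _ _
      _ ≤ Nx.card • ENNReal.ofReal (2 * Real.exp (-(n / 4 : ℝ))) := Finset.sum_le_card_nsmul _ _ _ hG
      _ = ENNReal.ofReal (Nx.card * (2 * Real.exp (-(n / 4 : ℝ)))) := by
        rw [ENNReal.ofReal_mul (Nat.cast_nonneg _), ENNReal.ofReal_natCast, nsmul_eq_mul]
      _ ≤ ENNReal.ofReal ((21 : ℝ) ^ dx * (2 * Real.exp (-(n / 4 : ℝ)))) := by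
        gcongr
        exact_mod_cast hNxc
      -- The sample size is used here: `24 = 4 · 6` gives `n/4 ≥ 6 dx + log(1/δ)`.
      _ ≤ ENNReal.ofReal (δ / 2) :=
        ENNReal.ofReal_le_ofReal (net_union_bound hdx le_rfl hδ (by linarith))
  · calc P (⋃ v ∈ Nx, ⋃ w ∈ Ny, B v w)
        ≤ ∑ v ∈ Nx, P (⋃ w ∈ Ny, B v w) := measure_biUnion_finset_le _ _
      _ ≤ ∑ v ∈ Nx, ∑ w ∈ Ny, P (B v w) :=
        Finset.sum_le_sum fun v _ => measure_biUnion_finset_le _ _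
      _ ≤ ∑ v ∈ Nx, Ny.card • ENNReal.ofReal (2 * Real.exp (-s)) :=
        Finset.sum_le_sum fun v hv => Finset.sum_le_card_nsmul _ _ _ (hB v hv)
      _ = ENNReal.ofReal ((Nx.card * Ny.card : ℕ) * (2 * Real.exp (-s))) := by
        rw [ENNReal.ofReal_mul (Nat.cast_nonneg _), ENNReal.ofReal_natCast, Finset.sum_const,
          nsmul_eq_mul, nsmul_eq_mul, Nat.cast_mul, mul_assoc]
      _ ≤ ENNReal.ofReal ((21 : ℝ) ^ (dx + dy) * (2 * Real.exp (-s))) := by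
        gcongr
        rw [pow_add]
        exact_mod_cast Nat.mul_le_mul hNxc hNyc
      _ ≤ ENNReal.ofReal (δ / 2) :=
        ENNReal.ofReal_le_ofReal (net_union_bound hdx (Nat.le_add_right _ _) hδ
          (by rw [hs]; push_cast; rfl))

end Design

/-! ### Frobenius norms, row spaces and orthonormal families. -/

section FrobeniusNorm

variable {p q : ℕ}

theorem frobenius_norm_sq_eq_sum (M : Matrix (Fin p) (Fin q) ℝ) :
    ‖M‖ ^ 2 = ∑ i, ∑ j, M i j ^ 2 := by
  rw [Matrix.frobenius_norm_def, ← Real.sqrt_eq_rpow, Real.sq_sqrt (by positivity)]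
  simp

theorem frobenius_norm_sq_eq_sum_rows (M : Matrix (Fin p) (Fin q) ℝ) :
    ‖M‖ ^ 2 = ∑ i, ‖(WithLp.toLp 2 (M i) : EuclideanSpace ℝ (Fin q))‖ ^ 2 := by
  simp [frobenius_norm_sq_eq_sum, EuclideanSpace.real_norm_sq_eq]

/-- The span of the rows of `M` in Euclidean space. -/
def rowSpan (M : Matrix (Fin p) (Fin q) ℝ) : Submodule ℝ (EuclideanSpace ℝ (Fin q)) :=
  Submodule.span ℝ (Set.range fun i => WithLp.toLp 2 (M i))

theorem finrank_rowSpan (M : Matrix (Fin p) (Fin q) ℝ) :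
    Module.finrank ℝ (rowSpan M) = M.rank := by
  rw [Matrix.rank_eq_finrank_span_row,
    ← LinearEquiv.finrank_map_eq (WithLp.linearEquiv 2 ℝ (Fin q → ℝ)).symm, Submodule.map_span,
    ← Set.range_comp]
  rfl

theorem row_mem_rowSpan (M : Matrix (Fin p) (Fin q) ℝ) (i : Fin p) :
    (WithLp.toLp 2 (M i) : EuclideanSpace ℝ (Fin q)) ∈ rowSpan M :=
  Submodule.subset_span ⟨i, rfl⟩

end FrobeniusNorm

section InnerProduct

variable {E : Type*} [NormedAddCommGroup E] [InnerProductSpace ℝ E]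

/-- Stands in for the orthogonal projection onto `V`: a vector of `V` sees `y` only through its
coordinates along `f`. -/
theorem exists_orthonormal_inner_eq_sum (V : Submodule ℝ E) [FiniteDimensional ℝ V] :
    ∃ f : Fin (Module.finrank ℝ V) → E, Orthonormal ℝ f ∧
      ∀ x ∈ V, ∀ y : E, (inner ℝ x y : ℝ) = ∑ j, inner ℝ (f j) x * inner ℝ (f j) y := by
  let b := stdOrthonormalBasis ℝ V
  refine ⟨fun j => b j, b.orthonormal.comp_linearIsometry V.subtypeₗᵢ, fun x hx y => ?_⟩
  have h : x = ∑ j, (inner ℝ (b j : E) x : ℝ) • (b j : E) := by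
    have := congrArg (Submodule.subtype V) (b.sum_repr' ⟨x, hx⟩)
    simpa using this.symm
  conv_lhs => rw [h]
  rw [sum_inner]
  simp [real_inner_smul_left]

theorem norm_sq_sum_smul_of_orthonormal {ι : Type*} {v : ι → E} (hv : Orthonormal ℝ v)
    (s : Finset ι) (c : ι → ℝ) : ‖∑ i ∈ s, c i • v i‖ ^ 2 = ∑ i ∈ s, c i ^ 2 := by
  rw [← real_inner_self_eq_norm_sq, hv.inner_sum]
  simp [sq]

theorem sum_inner_sq_le_of_orthonormal {ι : Type*} [Fintype ι] {v : ι → E} (hv : Orthonormal ℝ v)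
    (x : E) : ∑ i, (inner ℝ (v i) x : ℝ) ^ 2 ≤ ‖x‖ ^ 2 := by
  simpa using hv.sum_inner_products_le x (s := Finset.univ)

end InnerProduct

/-! ### Low-rank approximation. -/

/-- A weighted sum with weights in `[0, 1]` is dominated by the sum over a set `T` on which the
values lie above a threshold, up to the excess of the weights. -/
theorem sum_weighted_le_sum_threshold {ι : Type*} [Fintype ι] (w a : ι → ℝ) (T : Finset ι) (θ : ℝ)
    (hw0 : ∀ i, 0 ≤ w i) (hw1 : ∀ i, w i ≤ 1) (hT : ∀ i ∈ T, θ ≤ a i) (hT' : ∀ i ∉ T, a i ≤ θ) :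
    ∑ i, w i * a i ≤ ∑ i ∈ T, a i + θ * (∑ i, w i - T.card) := by
  classical
  have h : ∑ i, w i * (a i - θ) ≤ ∑ i, if i ∈ T then a i - θ else 0 := by
    refine Finset.sum_le_sum fun i _ => ?_
    split_ifs with hi
    · exact mul_le_of_le_one_left (sub_nonneg.2 (hT i hi)) (hw1 i)
    · exact mul_nonpos_of_nonneg_of_nonpos (hw0 i) (sub_nonpos.2 (hT' i hi))
  rw [Finset.sum_ite_mem, Finset.univ_inter, Finset.sum_sub_distrib, Finset.sum_const,
    nsmul_eq_mul] at h
  simp only [mul_sub, Finset.sum_sub_distrib, ← Finset.sum_mul] at h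
  linarith

section EckartYoung

variable {p q m : ℕ}

theorem frobenius_norm_sq_sum_vecMulVec {u : Fin m → EuclideanSpace ℝ (Fin p)}
    {v : Fin m → EuclideanSpace ℝ (Fin q)} (hu : Orthonormal ℝ u) (hv : Orthonormal ℝ v)
    (s : Fin m → ℝ) (I : Finset (Fin m)) :
    ‖∑ i ∈ I, s i • Matrix.vecMulVec (u i) (v i)‖ ^ 2 = ∑ i ∈ I, s i ^ 2 := by
  rw [frobenius_norm_sq_eq_sum_rows]
  have h : ∀ k, (WithLp.toLp 2 ((∑ i ∈ I, s i • Matrix.vecMulVec (u i) (v i)) k) :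
      EuclideanSpace ℝ (Fin q)) = ∑ i ∈ I, (s i * u i k) • v i := fun k => by
    ext j
    simp [Matrix.sum_apply, Matrix.vecMulVec_apply, mul_assoc]
  simp only [h, norm_sq_sum_smul_of_orthonormal hv]
  rw [Finset.sum_comm]
  refine Finset.sum_congr rfl fun i _ => ?_
  simp only [mul_pow]
  rw [← Finset.mul_sum, ← EuclideanSpace.real_norm_sq_eq, hu.1 i]
  ring

/-- Both sides are `‖Mᵀ x‖²`, the right one expanded in the right singular vectors. -/
theorem IsSVD.sum_inner_cols_sq {M : Matrix (Fin p) (Fin q) ℝ} {s : Fin m → ℝ}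
    {u : Fin m → EuclideanSpace ℝ (Fin p)} {v : Fin m → EuclideanSpace ℝ (Fin q)}
    (h : IsSVD M s u v) (x : EuclideanSpace ℝ (Fin p)) :
    ∑ j, (inner ℝ x (WithLp.toLp 2 (Mᵀ j)) : ℝ) ^ 2 = ∑ i, inner ℝ x (u i) ^ 2 * s i ^ 2 := by
  have h1 : ∀ j, (inner ℝ x (WithLp.toLp 2 (Mᵀ j)) : ℝ) =
      (∑ i, (inner ℝ x (u i) * s i : ℝ) • v i) j := fun j => by
    have h2 : (WithLp.toLp 2 (Mᵀ j) : EuclideanSpace ℝ (Fin p)) = ∑ i, (s i * v i j) • u i := by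
      ext k
      simp only [Matrix.transpose_apply, h.eq_sum]
      simp only [Matrix.sum_apply, Matrix.smul_apply, Matrix.vecMulVec_apply, WithLp.ofLp_sum,
        Finset.sum_apply, WithLp.ofLp_smul, Pi.smul_apply, smul_eq_mul]
      exact Finset.sum_congr rfl fun i _ => by ring
    rw [h2, inner_sum]
    simp only [real_inner_smul_right, WithLp.ofLp_sum, Finset.sum_apply,
      WithLp.ofLp_smul, Pi.smul_apply, smul_eq_mul]
    exact Finset.sum_congr rfl fun i _ => by ring
  simp only [h1]
  rw [← EuclideanSpace.real_norm_sq_eq, norm_sq_sum_smul_of_orthonormal h.orthonormal_right]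
  simp [mul_pow]

/-- **Eckart-Young theorem** for the Frobenius norm. -/
theorem IsSVD.norm_truncation_sub_le {M : Matrix (Fin p) (Fin q) ℝ} {s : Fin m → ℝ}
    {u : Fin m → EuclideanSpace ℝ (Fin p)} {v : Fin m → EuclideanSpace ℝ (Fin q)}
    (h : IsSVD M s u v) {r : ℕ} {A : Matrix (Fin p) (Fin q) ℝ} (hA : A.rank ≤ r) :
    ‖(∑ i with i.val < r, s i • Matrix.vecMulVec (u i) (v i)) - M‖ ^ 2 ≤ ‖A - M‖ ^ 2 := by
  classical
  set T : Finset (Fin m) := Finset.univ.filter fun i => i.val < r with hTdef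
  obtain ⟨f, hf, hfV⟩ := exists_orthonormal_inner_eq_sum (rowSpan Aᵀ)
  have hk : (Module.finrank ℝ (rowSpan Aᵀ) : ℝ) ≤ r := by
    rw [finrank_rowSpan, Matrix.rank_transpose]
    exact_mod_cast hA
  -- `w i = ‖Π u_i‖²`, with `Π` the projection onto the column space of `A`. The columns of `A` are
  -- fixed by `Π`, so `‖A - M‖² ≥ ‖(1 - Π) M‖² = ‖M‖² - ∑ w s²`.
  let w : Fin m → ℝ := fun i => ∑ l, inner ℝ (f l) (u i) ^ 2
  have hcols : ‖M‖ ^ 2 - ∑ i, w i * s i ^ 2 ≤ ‖A - M‖ ^ 2 := by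
    have h1 : ∀ j, ‖(WithLp.toLp 2 (Mᵀ j) : EuclideanSpace ℝ (Fin p))‖ ^ 2
        - ∑ l, (inner ℝ (f l) (WithLp.toLp 2 (Mᵀ j)) : ℝ) ^ 2 ≤
        ‖(WithLp.toLp 2 ((A - M)ᵀ j) : EuclideanSpace ℝ (Fin p))‖ ^ 2 := fun j => by
      have h2 : (WithLp.toLp 2 ((A - M)ᵀ j) : EuclideanSpace ℝ (Fin p)) =
        WithLp.toLp 2 (Aᵀ j) - WithLp.toLp 2 (Mᵀ j) := by ext k; simp
      rw [h2, norm_sub_sq_real, ← real_inner_self_eq_norm_sq (WithLp.toLp 2 (Aᵀ j)),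
        hfV _ (row_mem_rowSpan Aᵀ j), hfV _ (row_mem_rowSpan Aᵀ j)]
      have h3 : 0 ≤ ∑ l, ((inner ℝ (f l) (WithLp.toLp 2 (Aᵀ j)) : ℝ) -
        inner ℝ (f l) (WithLp.toLp 2 (Mᵀ j))) ^ 2 := by positivity
      simp only [sub_sq, Finset.sum_add_distrib, Finset.sum_sub_distrib, mul_assoc,
        ← Finset.mul_sum] at h3
      simp only [← sq]
      linarith
    have h4 := Finset.sum_le_sum fun j (_ : j ∈ Finset.univ) => h1 j
    rw [Finset.sum_sub_distrib, ← frobenius_norm_sq_eq_sum_rows, ← frobenius_norm_sq_eq_sum_rows,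
      Matrix.frobenius_norm_transpose, Matrix.frobenius_norm_transpose, Finset.sum_comm] at h4
    simp only [h.sum_inner_cols_sq] at h4
    rw [Finset.sum_comm] at h4
    simpa only [w, Finset.sum_mul] using h4
  have hM : ‖M‖ ^ 2 = ∑ i, s i ^ 2 := by
    conv_lhs => rw [h.eq_sum]
    exact frobenius_norm_sq_sum_vecMulVec h.orthonormal_left h.orthonormal_right s _
  have hBM : ‖(∑ i ∈ T, s i • Matrix.vecMulVec (u i) (v i)) - M‖ ^ 2 = ∑ i ∈ Tᶜ, s i ^ 2 := by
    rw [← frobenius_norm_sq_sum_vecMulVec h.orthonormal_left h.orthonormal_right s Tᶜ,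
      norm_sub_rev]
    congr 2
    conv_lhs => rw [h.eq_sum]
    rw [sub_eq_iff_eq_add', Finset.sum_add_sum_compl]
  have hw1 : ∀ i, w i ≤ 1 := fun i => by
    refine (sum_inner_sq_le_of_orthonormal hf (u i)).trans ?_
    rw [h.orthonormal_left.1 i, one_pow]
  have hwsum : ∑ i, w i ≤ r := by
    refine le_trans ?_ hk
    simp only [w]
    rw [Finset.sum_comm]
    calc ∑ l, ∑ i, (inner ℝ (f l) (u i) : ℝ) ^ 2 ≤ ∑ l, ‖f l‖ ^ 2 :=
          Finset.sum_le_sum fun l _ => by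
            simpa only [real_inner_comm] using
              sum_inner_sq_le_of_orthonormal h.orthonormal_left (f l)
      _ = _ := by simp [hf.1]
  -- Weights at most `1` of total at most `r` do best on the `r` largest singular values. The
  -- threshold is `s r`, the first discarded one; if `m ≤ r` nothing is discarded.
  have hKF : ∑ i, w i * s i ^ 2 ≤ ∑ i ∈ T, s i ^ 2 := by
    have hw0 : ∀ i, 0 ≤ w i := fun i => by positivity
    have hanti : ∀ i j, i ≤ j → s j ^ 2 ≤ s i ^ 2 := fun i j hij =>
      pow_le_pow_left₀ (h.nonneg j) (h.antitone hij) 2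
    rcases lt_or_ge r m with hrm | hmr
    · have hTcard : T.card = r := by
        rw [hTdef, Fin.card_filter_val_lt]
        omega
      have := sum_weighted_le_sum_threshold w (fun i => s i ^ 2) T (s ⟨r, hrm⟩ ^ 2) hw0 hw1
        (fun i hi => hanti _ _ (by
          simp only [hTdef, Finset.mem_filter, Finset.mem_univ, true_and] at hi
          exact hi.le))
        (fun i hi => hanti _ _ (by
          simp only [hTdef, Finset.mem_filter, Finset.mem_univ, true_and, not_lt] at hi
          exact hi))
      rw [hTcard] at this
      nlinarith [sq_nonneg (s ⟨r, hrm⟩)]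
    · have hT : T = Finset.univ := by
        ext i
        simp only [hTdef, Finset.mem_filter, Finset.mem_univ, true_and, iff_true]
        exact i.2.trans_le hmr
      rw [hT]
      exact Finset.sum_le_sum fun i _ => mul_le_of_le_one_left (sq_nonneg _) (hw1 i)
  rw [hBM]
  have := Finset.sum_add_sum_compl T fun i => s i ^ 2
  linarith

/-- The error of a rank-`r` truncation of `M`, as an approximation of a matrix `A` of rank at most
`r`, is controlled by the action of `M - A` on at most `2 r` orthonormal vectors. -/
theorem IsRankTruncation.exists_norm_sub_sq_le {r : ℕ} {M B A : Matrix (Fin p) (Fin q) ℝ}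
    (h : IsRankTruncation r M B) (hA : A.rank ≤ r) :
    ∃ (k : ℕ) (f : Fin k → EuclideanSpace ℝ (Fin q)), k ≤ 2 * r ∧ Orthonormal ℝ f ∧
      ‖B - A‖ ^ 2 ≤ 4 * ∑ l, ∑ i, (inner ℝ (f l) (WithLp.toLp 2 ((M - A) i)) : ℝ) ^ 2 := by
  classical
  obtain ⟨m, s, u, v, hsvd, rfl⟩ := h
  have hEY := hsvd.norm_truncation_sub_le hA
  set T : Finset (Fin m) := Finset.univ.filter fun i => i.val < r with hTdef
  set B := ∑ i ∈ T, s i • Matrix.vecMulVec (u i) (v i) with hB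
  let V := rowSpan A ⊔ Submodule.span ℝ ((T.image v : Finset _) : Set (EuclideanSpace ℝ (Fin q)))
  obtain ⟨f, hf, hfV⟩ := exists_orthonormal_inner_eq_sum V
  refine ⟨_, f, ?_, hf, ?_⟩
  · refine (Submodule.finrank_add_le_finrank_add_finrank _ _).trans ?_
    have h1 := (finrank_span_finset_le_card (R := ℝ) (T.image v)).trans Finset.card_image_le
    have h2 : T.card ≤ r := by
      rw [hTdef, Fin.card_filter_val_lt]
      exact min_le_right _ _
    rw [finrank_rowSpan]
    exact (add_le_add hA (h1.trans h2)).trans (by omega)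
  have hrow : ∀ i, (WithLp.toLp 2 ((B - A) i) : EuclideanSpace ℝ (Fin q)) ∈ V := fun i => by
    have h1 : (WithLp.toLp 2 ((B - A) i) : EuclideanSpace ℝ (Fin q)) =
        ∑ l ∈ T, (s l * u l i) • v l - WithLp.toLp 2 (A i) := by
      ext j
      simp [hB, Matrix.sum_apply, Matrix.vecMulVec_apply, mul_assoc]
    rw [h1]
    refine Submodule.sub_mem _ (Submodule.sum_mem _ fun l hl => Submodule.smul_mem _ _ ?_) ?_
    · refine Submodule.mem_sup_right (Submodule.subset_span ?_)
      exact Finset.mem_coe.2 (Finset.mem_image_of_mem _ hl)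
    · exact Submodule.mem_sup_left (row_mem_rowSpan A i)
  -- The left side is `2⟪B - A, M - A⟫` on row `i`, bounded by `2ab ≤ a²/2 + 2b²` in the coordinates
  -- `f`. After summation Eckart-Young drops the two middle norms and `a²/2` is absorbed.
  have hbound : ∀ i, ‖(WithLp.toLp 2 ((B - A) i) : EuclideanSpace ℝ (Fin q))‖ ^ 2
      - ‖(WithLp.toLp 2 ((B - M) i) : EuclideanSpace ℝ (Fin q))‖ ^ 2
      + ‖(WithLp.toLp 2 ((A - M) i) : EuclideanSpace ℝ (Fin q))‖ ^ 2 ≤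
      1 / 2 * ‖(WithLp.toLp 2 ((B - A) i) : EuclideanSpace ℝ (Fin q))‖ ^ 2 +
      2 * ∑ l, (inner ℝ (f l) (WithLp.toLp 2 ((M - A) i)) : ℝ) ^ 2 := fun i => by
    have e1 : (WithLp.toLp 2 ((B - M) i) : EuclideanSpace ℝ (Fin q)) =
      WithLp.toLp 2 ((B - A) i) - WithLp.toLp 2 ((M - A) i) := by ext j; simp
    have e2 : ‖(WithLp.toLp 2 ((A - M) i) : EuclideanSpace ℝ (Fin q))‖ =
        ‖(WithLp.toLp 2 ((M - A) i) : EuclideanSpace ℝ (Fin q))‖ := by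
      rw [← norm_neg]; congr 1; ext j; simp
    have h0 : ‖(WithLp.toLp 2 ((B - A) i) : EuclideanSpace ℝ (Fin q))‖ ^ 2 =
        ∑ l, (inner ℝ (f l) (WithLp.toLp 2 ((B - A) i)) : ℝ) ^ 2 := by
      rw [← real_inner_self_eq_norm_sq, hfV _ (hrow i)]
      simp only [← sq]
    have h1 : 2 * (inner ℝ (WithLp.toLp 2 ((B - A) i) : EuclideanSpace ℝ (Fin q))
        (WithLp.toLp 2 ((M - A) i)) : ℝ) ≤
        1 / 2 * ‖(WithLp.toLp 2 ((B - A) i) : EuclideanSpace ℝ (Fin q))‖ ^ 2 +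
        2 * ∑ l, (inner ℝ (f l) (WithLp.toLp 2 ((M - A) i)) : ℝ) ^ 2 := by
      rw [h0, hfV _ (hrow i), Finset.mul_sum, Finset.mul_sum, Finset.mul_sum,
        ← Finset.sum_add_distrib]
      refine Finset.sum_le_sum fun l _ => ?_
      nlinarith [sq_nonneg ((inner ℝ (f l) (WithLp.toLp 2 ((B - A) i)) : ℝ) -
        2 * inner ℝ (f l) (WithLp.toLp 2 ((M - A) i)))]
    rw [e1, e2, norm_sub_sq_real]
    linarith
  have hsum := Finset.sum_le_sum fun i (_ : i ∈ Finset.univ) => hbound i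
  simp only [Finset.sum_add_distrib, Finset.sum_sub_distrib, ← Finset.mul_sum,
    ← frobenius_norm_sq_eq_sum_rows] at hsum
  rw [Finset.sum_comm] at hsum
  linarith

end EckartYoung

/-! ### Normal equations. -/

section LeastSquares

variable {n dx dy : ℕ}

/-- The normal equations of least squares, tested against rank-one matrices. -/
theorem IsLSE.normal_equation {X : Matrix (Fin n) (Fin dx) ℝ} {Y : Matrix (Fin n) (Fin dy) ℝ}
    {B : Matrix (Fin dy) (Fin dx) ℝ} (h : IsLSE X Y B) (b : Fin dx → ℝ) (w : Fin dy → ℝ) :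
    ∑ i, ∑ j, (Y - X * Bᵀ) i j * ((X *ᵥ b) i * w j) = 0 := by
  set c := ∑ i, ∑ j, (Y - X * Bᵀ) i j * ((X *ᵥ b) i * w j) with hc
  set e := ∑ i, ∑ j, ((X *ᵥ b) i * w j) ^ 2 with he
  have he0 : 0 ≤ e := by positivity
  have key : ∀ t : ℝ, 0 ≤ -2 * t * c + t ^ 2 * e := fun t => by
    have h1 := pow_le_pow_left₀ (norm_nonneg _) (h (B + t • Matrix.vecMulVec w b)) 2
    have h2 : ∀ i j, (Y - X * (B + t • Matrix.vecMulVec w b)ᵀ) i j =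
        (Y - X * Bᵀ) i j - t * ((X *ᵥ b) i * w j) := fun i j => by
      rw [Matrix.transpose_add, Matrix.transpose_smul, Matrix.transpose_vecMulVec, Matrix.mul_add,
        Matrix.mul_smul, Matrix.mul_vecMulVec]
      simp [Matrix.vecMulVec_apply, sub_sub]
    rw [frobenius_norm_sq_eq_sum, frobenius_norm_sq_eq_sum] at h1
    simp only [h2] at h1
    have h3 : ∑ i, ∑ j, ((Y - X * Bᵀ) i j - t * ((X *ᵥ b) i * w j)) ^ 2 =
        ∑ i, ∑ j, (Y - X * Bᵀ) i j ^ 2 + (-2 * t * c + t ^ 2 * e) := by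
      rw [hc, he]
      simp only [Finset.mul_sum, ← Finset.sum_add_distrib]
      exact Finset.sum_congr rfl fun i _ => Finset.sum_congr rfl fun j _ => by ring
    linarith
  -- Near-optimal `t`; the `+ 1` avoids a separate case `e = 0`.
  have h1 := key (c / (e + 1))
  have h2 : -2 * (c / (e + 1)) * c + (c / (e + 1)) ^ 2 * e =
      -(c ^ 2 * (e + 2) / (e + 1) ^ 2) := by
    field_simp
    ring
  rw [h2, neg_nonneg] at h1
  have h3 : c ^ 2 * (e + 2) ≤ 0 := by
    by_contra! h4
    have : 0 < c ^ 2 * (e + 2) / (e + 1) ^ 2 := by positivity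
    linarith
  have h4 : c ^ 2 ≤ 0 := by nlinarith [sq_nonneg c]
  exact pow_eq_zero_iff two_ne_zero |>.1 (le_antisymm h4 (sq_nonneg c))

/-- The residual is `η i - (B - A) x i`, so the normal equations become an identity for the error
alone; the long sum is `(B - A)ᵀ w`. -/
theorem IsLSE.sum_inner_mul_inner_eq {X : Matrix (Fin n) (Fin dx) ℝ}
    {Y : Matrix (Fin n) (Fin dy) ℝ} {A B : Matrix (Fin dy) (Fin dx) ℝ}
    {x : Fin n → EuclideanSpace ℝ (Fin dx)} {η : Fin n → EuclideanSpace ℝ (Fin dy)}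
    (hX : ∀ i j, X i j = x i j) (hY : ∀ i j, Y i j = (A *ᵥ (x i)) j + η i j)
    (h : IsLSE X Y B) (b : EuclideanSpace ℝ (Fin dx)) (w : EuclideanSpace ℝ (Fin dy)) :
    ∑ i, (inner ℝ b (x i) : ℝ) * inner ℝ (∑ j, w j • (WithLp.toLp 2 ((B - A) j) :
      EuclideanSpace ℝ (Fin dx))) (x i) = ∑ i, (inner ℝ b (x i) : ℝ) * inner ℝ w (η i) := by
  have h1 := h.normal_equation b w
  have hres : ∀ i j, (Y - X * Bᵀ) i j = η i j -
      inner ℝ (WithLp.toLp 2 ((B - A) j) : EuclideanSpace ℝ (Fin dx)) (x i) := fun i j => by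
    simp only [Matrix.sub_apply, hY, Matrix.mul_apply, hX, Matrix.transpose_apply, Matrix.mulVec,
      dotProduct, PiLp.inner_apply, RCLike.inner_apply, conj_trivial, mul_sub,
      Finset.sum_sub_distrib]
    have : ∑ k, A j k * x i k = ∑ k, x i k * A j k :=
      Finset.sum_congr rfl fun k _ => mul_comm _ _
    linarith
  have hXb : ∀ i, (X *ᵥ b) i = inner ℝ b (x i) := fun i => by
    simp [Matrix.mulVec, dotProduct, hX, PiLp.inner_apply]
  simp only [hres, hXb] at h1
  rw [← sub_eq_zero, ← Finset.sum_sub_distrib, ← neg_eq_zero, ← h1, ← Finset.sum_neg_distrib]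
  refine Finset.sum_congr rfl fun i _ => ?_
  have h2 : (inner ℝ w (η i) : ℝ) = ∑ j, w j * η i j := by
    rw [PiLp.inner_apply]
    exact Finset.sum_congr rfl fun j _ => by simp [mul_comm]
  rw [h2, sum_inner]
  simp only [real_inner_smul_left, Finset.mul_sum]
  rw [← Finset.sum_sub_distrib, ← Finset.sum_neg_distrib]
  exact Finset.sum_congr rfl fun j _ => by ring

end LeastSquares

/-! ### Whitening and the spectrum of the covariance. -/

section Whitening

variable {n dx dy : ℕ}

/-- The coordinates `⟪e k, x⟫ / √(lam k)`, which whiten a vector with principal axes `e` and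
variances `lam`. -/
noncomputable def whiten (e : OrthonormalBasis (Fin dx) ℝ (EuclideanSpace ℝ (Fin dx)))
    (lam : Fin dx → ℝ) (x : EuclideanSpace ℝ (Fin dx)) : EuclideanSpace ℝ (Fin dx) :=
  WithLp.toLp 2 fun k => inner ℝ (e k) x / √(lam k)

theorem measurable_whiten (e : OrthonormalBasis (Fin dx) ℝ (EuclideanSpace ℝ (Fin dx)))
    (lam : Fin dx → ℝ) : Measurable (whiten e lam) := by
  unfold whiten
  fun_prop

theorem norm_sq_whiten (e : OrthonormalBasis (Fin dx) ℝ (EuclideanSpace ℝ (Fin dx)))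
    {lam : Fin dx → ℝ} (hlam : ∀ k, 0 < lam k) (x : EuclideanSpace ℝ (Fin dx)) :
    ‖whiten e lam x‖ ^ 2 = ∑ k, inner ℝ (e k) x ^ 2 * (lam k)⁻¹ := by
  simp only [whiten, EuclideanSpace.real_norm_sq_eq, div_pow, Real.sq_sqrt (hlam _).le]
  rfl

/-- The vector whose pairing with `whiten e lam x` is the pairing of `b` with `x`. -/
noncomputable def unwhiten (e : OrthonormalBasis (Fin dx) ℝ (EuclideanSpace ℝ (Fin dx)))
    (lam : Fin dx → ℝ) (b : EuclideanSpace ℝ (Fin dx)) : EuclideanSpace ℝ (Fin dx) :=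
  WithLp.toLp 2 fun k => √(lam k) * inner ℝ (e k) b

theorem inner_unwhiten_whiten (e : OrthonormalBasis (Fin dx) ℝ (EuclideanSpace ℝ (Fin dx)))
    {lam : Fin dx → ℝ} (hlam : ∀ k, 0 < lam k) (b x : EuclideanSpace ℝ (Fin dx)) :
    (inner ℝ (unwhiten e lam b) (whiten e lam x) : ℝ) = inner ℝ b x := by
  rw [← e.sum_inner_mul_inner b x, PiLp.inner_apply]
  refine Finset.sum_congr rfl fun k _ => ?_
  have : √(lam k) ≠ 0 := (Real.sqrt_pos.2 (hlam k)).ne'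
  simp only [unwhiten, whiten, RCLike.inner_apply, conj_trivial, real_inner_comm (e k) b]
  field_simp

theorem inner_whiten (e : OrthonormalBasis (Fin dx) ℝ (EuclideanSpace ℝ (Fin dx)))
    (lam : Fin dx → ℝ) (u x : EuclideanSpace ℝ (Fin dx)) :
    (inner ℝ u (whiten e lam x) : ℝ) = inner ℝ (∑ k, (u k / √(lam k)) • e k) x := by
  rw [sum_inner, PiLp.inner_apply]
  refine Finset.sum_congr rfl fun k _ => ?_
  simp only [whiten, RCLike.inner_apply, conj_trivial, real_inner_smul_left]
  ring

/-- The one-dimensional marginals of a whitened Gaussian vector in unit directions are standard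
Gaussian. -/
theorem hasLaw_inner_whiten {S : Matrix (Fin dx) (Fin dx) ℝ} (hS : S.PosDef)
    {Ω : Type*} [MeasurableSpace Ω] {P : Measure Ω} {x : Ω → EuclideanSpace ℝ (Fin dx)}
    (hx : HasLaw x (multivariateGaussian 0 S) P) {u : EuclideanSpace ℝ (Fin dx)} (hu : ‖u‖ = 1) :
    HasLaw (fun ω => inner ℝ u
      (whiten hS.isHermitian.eigenvectorBasis hS.isHermitian.eigenvalues (x ω)))
      (gaussianReal 0 1) P := by
  set e := hS.isHermitian.eigenvectorBasis
  set lam := hS.isHermitian.eigenvalues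
  have hlam : ∀ k, 0 < lam k := hS.eigenvalues_pos
  set a : EuclideanSpace ℝ (Fin dx) := ∑ k, (u k / √(lam k)) • e k with ha
  -- The variance in direction `a` is `‖u‖²`: each factor `lam k` cancels the two factors `1 / √(lam
  -- k)`.
  have hvar : (a : Fin dx → ℝ) ⬝ᵥ S *ᵥ a = 1 := by
    have h1 : S *ᵥ a = WithLp.ofLp (∑ k, (u k * √(lam k)) • e k) := by
      rw [ha, WithLp.ofLp_sum, WithLp.ofLp_sum, Matrix.mulVec_sum]
      refine Finset.sum_congr rfl fun k _ => ?_
      rw [WithLp.ofLp_smul, WithLp.ofLp_smul, Matrix.mulVec_smul,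
        hS.isHermitian.mulVec_eigenvectorBasis, smul_smul]
      congr 1
      have : √(lam k) ≠ 0 := (Real.sqrt_pos.2 (hlam k)).ne'
      have h2 : √(lam k) ^ 2 = lam k := Real.sq_sqrt (hlam k).le
      change u k / √(lam k) * lam k = _
      field_simp
      rw [h2]
    have h3 : (a : Fin dx → ℝ) ⬝ᵥ S *ᵥ a = inner ℝ a (∑ k, (u k * √(lam k)) • e k) := by
      rw [h1, PiLp.inner_apply]
      simp [dotProduct, mul_comm]
    rw [h3, ha, e.orthonormal.inner_sum]
    rw [← one_pow 2, ← hu, EuclideanSpace.real_norm_sq_eq]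
    refine Finset.sum_congr rfl fun k _ => ?_
    have : √(lam k) ≠ 0 := (Real.sqrt_pos.2 (hlam k)).ne'
    simp only [conj_trivial]
    field_simp
  have hlaw : (multivariateGaussian 0 S).map (innerSL ℝ a) = gaussianReal 0 1 := by
    rw [IsGaussian.map_eq_gaussianReal]
    congr 1
    · have h4 := (innerSL ℝ a).integral_comp_comm
        (IsGaussian.integrable_fun_id (μ := multivariateGaussian 0 S))
      rw [h4]
      simp
    · have h4 := covarianceBilin_multivariateGaussian (μ := 0) hS.posSemidef a a
      rw [hvar, covarianceBilin_apply_eq_cov IsGaussian.memLp_two_id,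
        covariance_self (by fun_prop)] at h4
      have h5 : Var[innerSL ℝ a; multivariateGaussian 0 S] = 1 := h4
      rw [h5, Real.toNNReal_one]
  have hL : HasLaw (innerSL ℝ a) (gaussianReal 0 1) (multivariateGaussian 0 S) :=
    ⟨by fun_prop, hlaw⟩
  refine (hL.comp hx).congr (ae_of_all _ fun ω => ?_)
  simp only [Function.comp_apply, innerSL_apply_apply]
  exact inner_whiten e lam u (x ω)

/-- The error matrix of least squares contracts each direction according to its whitened norm. -/
theorem IsLSE.sum_inner_row_sq_le {X : Matrix (Fin n) (Fin dx) ℝ}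
    {Y : Matrix (Fin n) (Fin dy) ℝ} {A B : Matrix (Fin dy) (Fin dx) ℝ}
    {x : Fin n → EuclideanSpace ℝ (Fin dx)} {η : Fin n → EuclideanSpace ℝ (Fin dy)}
    (hX : ∀ i j, X i j = x i j) (hY : ∀ i j, Y i j = (A *ᵥ (x i)) j + η i j)
    (h : IsLSE X Y B) (e : OrthonormalBasis (Fin dx) ℝ (EuclideanSpace ℝ (Fin dx)))
    {lam : Fin dx → ℝ} (hlam : ∀ k, 0 < lam k) {κ K : ℝ} (hκ : 0 < κ) (hK : 0 ≤ K)
    (h1 : ∀ u, κ * ‖u‖ ^ 2 ≤ ∑ i, (inner ℝ u (whiten e lam (x i)) : ℝ) ^ 2)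
    (h2 : ∀ u w, ∑ i, (inner ℝ u (whiten e lam (x i)) : ℝ) * inner ℝ w (η i) ≤ K * ‖u‖ * ‖w‖)
    (f : EuclideanSpace ℝ (Fin dx)) :
    ∑ j, (inner ℝ f (WithLp.toLp 2 ((B - A) j)) : ℝ) ^ 2 ≤
      (K / κ) ^ 2 * ∑ k, inner ℝ (e k) f ^ 2 * (lam k)⁻¹ := by
  rw [← norm_sq_whiten e hlam]
  -- `w = (B - A) f` and `b = (B - A)ᵀ w`, so that `⟪b, f⟫ = ‖w‖²`.
  set w : EuclideanSpace ℝ (Fin dy) :=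
    WithLp.toLp 2 fun j => inner ℝ f (WithLp.toLp 2 ((B - A) j)) with hw
  set b : EuclideanSpace ℝ (Fin dx) := ∑ j, w j • WithLp.toLp 2 ((B - A) j) with hb
  have hnorm : ∑ j, (inner ℝ f (WithLp.toLp 2 ((B - A) j)) : ℝ) ^ 2 = ‖w‖ ^ 2 := by
    rw [EuclideanSpace.real_norm_sq_eq]
  have hbf : (inner ℝ b f : ℝ) = ‖w‖ ^ 2 := by
    rw [← hnorm, hb, sum_inner]
    refine Finset.sum_congr rfl fun j _ => ?_
    rw [real_inner_smul_left, real_inner_comm, hw, sq]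
  have hne := h.sum_inner_mul_inner_eq hX hY b w
  rw [← hb] at hne
  have h3 := h1 (unwhiten e lam b)
  have h4 := h2 (unwhiten e lam b) w
  simp only [inner_unwhiten_whiten e hlam] at h3 h4
  simp only [← sq] at hne
  -- Testing the normal equations with `b` itself puts the quadratic form of `h3` on the left and
  -- the cross term of `h4` on the right.
  have h5 : κ * ‖unwhiten e lam b‖ ≤ K * ‖w‖ := by
    rcases (norm_nonneg (unwhiten e lam b)).eq_or_lt with h0 | h0
    · rw [← h0, mul_zero]; positivity
    · refine le_of_mul_le_mul_right ?_ h0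
      calc κ * ‖unwhiten e lam b‖ * ‖unwhiten e lam b‖ = κ * ‖unwhiten e lam b‖ ^ 2 := by ring
        _ ≤ K * ‖unwhiten e lam b‖ * ‖w‖ := h3.trans (hne.le.trans h4)
        _ = K * ‖w‖ * ‖unwhiten e lam b‖ := by ring
  have h6 : ‖w‖ ^ 2 ≤ ‖unwhiten e lam b‖ * ‖whiten e lam f‖ := by
    rw [← hbf, ← inner_unwhiten_whiten e hlam]
    exact real_inner_le_norm _ _
  rw [hnorm, ← mul_pow]
  refine pow_le_pow_left₀ (norm_nonneg _) ?_ 2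
  rcases (norm_nonneg w).eq_or_lt with h0 | h0
  · rw [← h0]; positivity
  · refine le_of_mul_le_mul_right ?_ h0
    calc ‖w‖ * ‖w‖ = ‖w‖ ^ 2 := by ring
      _ ≤ ‖unwhiten e lam b‖ * ‖whiten e lam f‖ := h6
      _ ≤ (K * ‖w‖ / κ) * ‖whiten e lam f‖ := by
        gcongr
        rw [le_div_iff₀ hκ]
        linarith
      _ = K / κ * ‖whiten e lam f‖ * ‖w‖ := by ring

/-- With `T` the `r` smallest eigenvalues, the weight in excess of `r` is at most `r`, and each unit
of it costs at most the least reciprocal on `T`. The copy `d'` of the dimension accommodates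
`eigenvalues₀`, indexed by `Fin (Fintype.card (Fin dx))`. -/
theorem sum_weighted_inv_le {d d' r : ℕ} (hdd : d' = d) (hr : 1 ≤ r) (hrd : r ≤ d)
    {lam : Fin d' → ℝ} (hlam : ∀ i, 0 < lam i) (hanti : Antitone lam) {w : Fin d' → ℝ}
    (hw0 : ∀ i, 0 ≤ w i) (hw1 : ∀ i, w i ≤ 1) (hw : ∑ i, w i ≤ 2 * r) :
    ∑ i, w i * (lam i)⁻¹ ≤ 2 * ∑ i with d ≤ i.val + r, (lam i)⁻¹ := by
  classical
  subst hdd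
  set T : Finset (Fin d') := Finset.univ.filter fun i => d' ≤ i.val + r with hT
  have hmem : ∀ i : Fin d', i ∈ T ↔ d' ≤ i.val + r := fun i => by simp [hT]
  let i₀ : Fin d' := ⟨d' - r, by omega⟩
  have hTcard : T.card = r := by
    have h1 : T = Finset.Ici i₀ := by
      ext i
      rw [hmem, Finset.mem_Ici, Fin.le_def]
      simp only [i₀]
      omega
    rw [h1, Fin.card_Ici]
    simp only [i₀]
    omega
  have hge : ∀ i ∈ T, (lam i₀)⁻¹ ≤ (lam i)⁻¹ := fun i hi => by
    have h1 : lam i ≤ lam i₀ := hanti (by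
      rw [hmem] at hi
      rw [Fin.le_def]
      simp only [i₀]
      omega)
    have := hlam i
    gcongr
  have hle : ∀ i ∉ T, (lam i)⁻¹ ≤ (lam i₀)⁻¹ := fun i hi => by
    have h1 : lam i₀ ≤ lam i := hanti (by
      rw [hmem] at hi
      rw [Fin.le_def]
      simp only [i₀]
      omega)
    have := hlam i₀
    gcongr
  have h1 := sum_weighted_le_sum_threshold w (fun i => (lam i)⁻¹) T (lam i₀)⁻¹ hw0 hw1 hge hle
  have h2 := Finset.card_nsmul_le_sum T (fun i => (lam i)⁻¹) _ hge
  rw [hTcard, nsmul_eq_mul] at h2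
  rw [hTcard] at h1
  have h3 : 0 < (lam i₀)⁻¹ := inv_pos.2 (hlam i₀)
  nlinarith

/-- The left side is the trace of `S⁻¹` on the span of `f`. The weight of an eigenvector is its
squared projection onto this span: at most `1`, with total `k`. -/
theorem sum_sum_inner_sq_div_eigenvalues_le {S : Matrix (Fin dx) (Fin dx) ℝ} (hS : S.PosDef)
    {r k : ℕ} (hr : 1 ≤ r) (hrd : r ≤ dx) (hk : k ≤ 2 * r)
    {f : Fin k → EuclideanSpace ℝ (Fin dx)} (hf : Orthonormal ℝ f) :
    ∑ l, ∑ i, (inner ℝ (hS.isHermitian.eigenvectorBasis i) (f l) : ℝ) ^ 2 *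
        (hS.isHermitian.eigenvalues i)⁻¹ ≤
      2 * ∑ i with dx ≤ i.val + r, (hS.isHermitian.eigenvalues₀ i)⁻¹ := by
  set e := hS.isHermitian.eigenvectorBasis
  -- The reindexing through which `eigenvalues` is defined from the sorted `eigenvalues₀`.
  let g : Fin (Fintype.card (Fin dx)) ≃ Fin dx := Fintype.equivOfCardEq (Fintype.card_fin _)
  have hval : ∀ i, hS.isHermitian.eigenvalues (g i) = hS.isHermitian.eigenvalues₀ i := fun i => by
    simp [Matrix.IsHermitian.eigenvalues, g]
  have hpos : ∀ i, 0 < hS.isHermitian.eigenvalues₀ i := fun i => by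
    rw [← hval]
    exact hS.eigenvalues_pos _
  have h := sum_weighted_inv_le (Fintype.card_fin dx) hr hrd hpos
    hS.isHermitian.eigenvalues₀_antitone
    (w := fun i => ∑ l, (inner ℝ (e (g i)) (f l) : ℝ) ^ 2) (fun i => by positivity)
    (fun i => ?_) ?_
  · refine le_trans (le_of_eq ?_) h
    rw [Finset.sum_comm, ← g.sum_comp]
    exact Finset.sum_congr rfl fun i _ => by rw [hval, Finset.sum_mul]
  · calc ∑ l, (inner ℝ (e (g i)) (f l) : ℝ) ^ 2 = ∑ l, (inner ℝ (f l) (e (g i)) : ℝ) ^ 2 :=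
          Finset.sum_congr rfl fun l _ => by rw [real_inner_comm]
      _ ≤ ‖e (g i)‖ ^ 2 := sum_inner_sq_le_of_orthonormal hf (e (g i))
      _ = 1 := by rw [e.orthonormal.1, one_pow]
  · rw [g.sum_comp fun i => ∑ l, (inner ℝ (e i) (f l) : ℝ) ^ 2, Finset.sum_comm]
    calc ∑ l, ∑ i, (inner ℝ (e i) (f l) : ℝ) ^ 2 ≤ ∑ l, ‖f l‖ ^ 2 :=
          Finset.sum_le_sum fun l _ => sum_inner_sq_le_of_orthonormal e.orthonormal (f l)
      _ = k := by simp [hf.1]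
      _ ≤ 2 * r := by exact_mod_cast hk

end Whitening

/-! ### Assembly of the bound. -/

theorem mainTheorem4 :
    ∃ c C : ℝ, 0 < c ∧ 0 < C ∧
      ∀ (n dx dy r : ℕ) (_ : 1 ≤ r) (_ : r ≤ dx)
        (A : Matrix (Fin dy) (Fin dx) ℝ) (_ : A.rank ≤ r)
        (S : Matrix (Fin dx) (Fin dx) ℝ) (hS : S.PosDef)
        (σ : ℝ≥0) (δ : ℝ) (_ : 0 < δ) (_ : δ < 1)
        (_ : c * (dx + Real.log (1 / δ)) ≤ n)
        (Ω : Type*) [MeasurableSpace Ω] (P : Measure Ω) [IsProbabilityMeasure P]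
        (x : Fin n → Ω → EuclideanSpace ℝ (Fin dx))
        (η : Fin n → Ω → EuclideanSpace ℝ (Fin dy))
        (_ : ∀ i, HasLaw (x i) (multivariateGaussian 0 S) P)
        (_ : iIndepFun x P)
        (_ : ∀ i, IsSubGaussianVector (η i) σ P)
        (_ : ∀ i j, IdentDistrib (η i) (η j) P P)
        (_ : iIndepFun η P)
        (_ : IndepFun (fun ω i => x i ω) (fun ω i => η i ω) P)
        (X : Ω → Matrix (Fin n) (Fin dx) ℝ) (_ : ∀ ω i j, X ω i j = x i ω j)
        (Y : Ω → Matrix (Fin n) (Fin dy) ℝ)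
        (_ : ∀ ω i j, Y ω i j = (A *ᵥ (x i ω)) j + η i ω j)
        (Ahat : Ω → Matrix (Fin dy) (Fin dx) ℝ) (_ : ∀ ω, IsRLSE r (X ω) (Y ω) (Ahat ω)),
        P {ω | ¬ ‖Ahat ω - A‖ ^ 2 ≤
            C * (r * (σ : ℝ) ^ 2 * (dx + dy + Real.log (1 / δ))
              / (n * lowerHarmonicMean hS.isHermitian r))}
          ≤ ENNReal.ofReal δ := by
  -- `400000` rounds up `4 · 8192 · 6 · 2 = 393216`.
  refine ⟨24, 400000, by norm_num, by norm_num, ?_⟩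
  intro n dx dy r hr hrdx A hA S hS σ δ hδ hδ1 hn Ω _ P _ x η hx hxi hη _ hηi hxη X hX Y hY Ahat
    hAhat
  have hdx : 1 ≤ dx := hr.trans hrdx
  have hlog : 0 ≤ Real.log (1 / δ) := Real.log_nonneg (by rw [le_div_iff₀ hδ]; linarith)
  have hdx' : (1 : ℝ) ≤ dx := by exact_mod_cast hdx
  have hn0 : (0 : ℝ) < n := by nlinarith
  have hr0 : (0 : ℝ) < r := by exact_mod_cast hr
  set e := hS.isHermitian.eigenvectorBasis
  set lam := hS.isHermitian.eigenvalues
  have hlam : ∀ k, 0 < lam k := hS.eigenvalues_pos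
  have hwm := measurable_whiten e lam
  have hφ : Measurable fun (y : Fin n → EuclideanSpace ℝ (Fin dx)) (i : Fin n) =>
    whiten e lam (y i) := measurable_pi_lambda _ fun i => hwm.comp (measurable_pi_apply i)
  have hzη : IndepFun (fun ω i => whiten e lam (x i ω)) (fun ω i => η i ω) P :=
    hxη.comp hφ measurable_id
  have hprob := measure_design_event_le hdx hδ hδ1 hn (fun i ω => whiten e lam (x i ω)) η
    (fun u hu i => hasLaw_inner_whiten hS (hx i) hu)
    (hxi.comp (fun _ => whiten e lam) fun _ => hwm) hη hηi hzη
  -- On the good event the bound is deterministic, so no measurability of `Ahat` is needed.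
  refine (measure_mono fun ω hω => ?_).trans hprob
  rw [Set.mem_ofPred_eq] at hω ⊢
  refine fun hgood => hω ?_
  obtain ⟨Abar, hlse, htrunc⟩ := hAhat ω
  obtain ⟨k, f, hk, hf, hbound⟩ := htrunc.exists_norm_sub_sq_le hA
  set s : ℝ := 6 * (dx + dy) + Real.log (1 / δ) with hs
  have hs0 : 0 ≤ s := by positivity
  set H := ∑ i with dx ≤ i.val + r, (hS.isHermitian.eigenvalues₀ i)⁻¹ with hH
  have hdir := fun l => hlse.sum_inner_row_sq_le (hX ω) (hY ω) e hlam (κ := (n : ℝ) / 16)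
    (by positivity) (by positivity) hgood.1 hgood.2 (f l)
  have hKF := sum_sum_inner_sq_div_eigenvalues_le hS hr hrdx hk hf
  have hsum0 : 0 ≤ ∑ l, ∑ i, (inner ℝ (e i) (f l) : ℝ) ^ 2 * (lam i)⁻¹ :=
    Finset.sum_nonneg fun l _ => Finset.sum_nonneg fun i _ =>
      mul_nonneg (sq_nonneg _) (inv_nonneg.2 (hlam i).le)
  have hH0 : 0 ≤ H := by linarith
  have hconst : (2 * (σ * √(8 * n * s)) / (n / 16 : ℝ)) ^ 2 = 8192 * (σ : ℝ) ^ 2 * s / n := by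
    rw [div_pow, mul_pow, mul_pow, Real.sq_sqrt (by positivity)]
    field_simp
    ring
  have hs6 : s ≤ 6 * (dx + dy + Real.log (1 / δ)) := by rw [hs]; linarith
  calc ‖Ahat ω - A‖ ^ 2
      ≤ 4 * ∑ l, ∑ i, (inner ℝ (f l) (WithLp.toLp 2 ((Abar - A) i)) : ℝ) ^ 2 := hbound
    _ ≤ 4 * ∑ l, (2 * (σ * √(8 * n * s)) / (n / 16 : ℝ)) ^ 2 *
          ∑ i, (inner ℝ (e i) (f l) : ℝ) ^ 2 * (lam i)⁻¹ := by
        gcongr with l _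
        exact hdir l
    _ = 4 * (8192 * (σ : ℝ) ^ 2 * s / n) *
          ∑ l, ∑ i, (inner ℝ (e i) (f l) : ℝ) ^ 2 * (lam i)⁻¹ := by
        rw [← Finset.mul_sum, hconst]
        ring
    _ ≤ 4 * (8192 * (σ : ℝ) ^ 2 * (6 * (dx + dy + Real.log (1 / δ))) / n) * (2 * H) := by gcongr
    _ = 393216 * ((σ : ℝ) ^ 2 * (dx + dy + Real.log (1 / δ)) * H / n) := by ring
    _ ≤ 400000 * ((σ : ℝ) ^ 2 * (dx + dy + Real.log (1 / δ)) * H / n) := by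
        gcongr
        norm_num
    _ = 400000 * (r * (σ : ℝ) ^ 2 * (dx + dy + Real.log (1 / δ))
              / (n * lowerHarmonicMean hS.isHermitian r)) := by
        rw [lowerHarmonicMean, ← hH]
        -- Only `0 ≤ H` is at hand; for `H = 0` both sides vanish by the convention on division by
        -- zero.
        rcases hH0.eq_or_lt with h0 | h0
        · rw [← h0]; simp
        · field_simp
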